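/- Let $\alpha\in(0,1)$, let $p\ge 2$ and $k\ge 1$ be integers, let $\beta\in(\max\{\alpha,\tfrac12\},1)$, and let $\mathbb T=\mathbb R/2\pi\mathbb Z$. Let $\mathcal X^\beta$ be the space of even, zero-mean, $\beta$-Hölder continuous functions $\varphi\colon\mathbb T\to\mathbb R$ with norm $\|\varphi\|_\infty+\sup_{x\ne y}|\varphi(x)-\varphi(y)|/|x-y|^\beta$, and let $|\mathrm D|^{-\alpha}$ be the Fourier multiplier with symbol $|m|^{-\alpha}$, $m\in\mathbb Z\setminus\{0\}$, acting on zero-mean functions. Consider the steady equation with $n(x)=x^p$, $$|\mathrm D|^{-\alpha}\varphi = c\,\varphi-\varphi^p+\frac1{2\pi}\int_{\mathbb T}\varphi^p,\qquad \varphi\in\mathcal X^\beta,\ c\in\mathbb R .\qquad(\ast)$$ By a local bifurcation curve at $(0,k^{-\alpha})$ we mean a curve $s\mapsto(\varphi(s),c(s))\in\mathcal X^\beta\times\mathbb R$, defined and analytic around $s=0$, with $(\varphi(0),c(0))=(0,k^{-\alpha})$, consisting of $2\pi/k$-periodic solutions of $(\ast)$ which are nontrivial for $s\neq0$, and such that in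 a neighbourhood of $(0,k^{-\alpha})$ all the solutions of $(\ast)$ with $\varphi\ne0$ lie on it (for each $\delta>0$ there is a neighbourhood of $(0,k^{-\alpha})$ in which every solution with $\varphi\neq 0$ is of the form $(\varphi(s),c(s))$ with $|s|<\delta$). **Theorem.** There is a local bifurcation curve at $(0,k^{-\alpha})$ parametrised by its $k$-th cosine coefficient, that is, with $$\frac1\pi\int_{\mathbb T}\varphi(s)(x)\cos(kx)\,dx=s\quad\text{for all } s \text{ near } 0 .$$ For every local bifurcation curve so parametrised, $c(-s)=c(s)$ for all $s$ near $0$, and as $s\to0$, $$\varphi(s)(x)=s\cos kx+s^p\,\Phi_k(x)+\mathcal O(s^{2p-1})\quad\text{in }\mathcal X^\beta,$$ with $\Phi_k=\Phi_k^{\mathrm{even}}$ if $p$ is even and $\Phi_k=\Phi_k^{\mathrm{odd}}$ if $p$ is odd, and $$c(s)=k^{-\alpha}+s^{2p-2}\,C_k^{\mathrm{even}}+\mathcal O(s^{2p})\ \ (p\text{ even}),\qquad c(s)=k^{-\alpha}+s^{p-1}\,C_k^{\mathrm{odd}}+\mathcal O(s^{2p-2})\ \ (p\text{ odd}).$$ Here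 $$C_{k,j}=\frac{\binom pj/2^{p-1}}{k^{-\alpha}-((p-2j)k)^{-\alpha}},\qquad \Phi_{k,j}(x)=C_{k,j}\cos\bigl((p-2j)kx\bigr),$$ $$\Phi_k^{\mathrm{even}}=\sum_{j=0}^{\frac p2-1}\Phi_{k,j},\qquad C_k^{\mathrm{even}}=\frac p{2^{p-1}}\Bigl(C_{k,0}+\sum_{j=1}^{\frac p2-1}\Bigl(\tbinom{p-1}{j}+\tbinom{p-1}{j-1}\Bigr)C_{k,j}\Bigr),$$ $$\Phi_k^{\mathrm{odd}}=\sum_{j=0}^{\frac{p-3}2}\Phi_{k,j},\qquad C_k^{\mathrm{odd}}=\frac1{2^{p-1}}\binom p{\frac{p-1}2}.$$ -/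

import Mathlib

open Real Filter Topology Asymptotics
open scoped NNReal

namespace NegDispersion

/-- The torus `𝕋 = ℝ / 2πℤ`. -/
abbrev Torus : Type := AddCircle (2 * π)

instance factTwoPiPos : Fact (0 < 2 * π) := ⟨Real.two_pi_pos⟩

/-- The mean `(1 / 2π) ∫_𝕋 u`. -/
noncomputable def torusMean (u : Torus → ℝ) : ℝ :=
  1 / (2 * π) * ∫ x in (-π)..π, u (x : Torus)

/-- The coefficient `(1 / π) ∫_𝕋 u(x) cos (m x) dx` in the cosine expansion of `u`. -/
noncomputable def cosCoeff (m : ℕ) (u : Torus → ℝ) : ℝ :=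
  1 / π * ∫ x in (-π)..π, u (x : Torus) * cos (m * x)

/-! ### The Banach space of even, zero-mean, `β`-Hölder functions on the torus -/

lemma intervalIntegrable_coe (f : C(Torus, ℝ)) (a b : ℝ) :
    IntervalIntegrable (fun x : ℝ => f (x : Torus)) MeasureTheory.volume a b :=
  (f.continuous.comp (AddCircle.continuous_mk' (2 * π))).intervalIntegrable a b

/-- The linear space of even, zero-mean, `β`-Hölder continuous real functions on `𝕋`. -/
noncomputable def holderEvenSubmodule (β : ℝ≥0) : Submodule ℝ C(Torus, ℝ) where
  carrier := {f | MemHolder β f ∧ (∀ x, f (-x) = f x) ∧ torusMean f = 0}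
  zero_mem' := ⟨memHolder_zero, fun _ => rfl, by simp [torusMean]⟩
  add_mem' := by
    rintro f g ⟨hf, hf', hf''⟩ ⟨hg, hg', hg''⟩
    refine ⟨hf.add hg, fun x => by simp [hf', hg'], ?_⟩
    simp only [torusMean, ContinuousMap.add_apply] at *
    rw [intervalIntegral.integral_add (intervalIntegrable_coe f _ _)
      (intervalIntegrable_coe g _ _), mul_add, hf'', hg'', add_zero]
  smul_mem' := by
    rintro a f ⟨hf, hf', hf''⟩
    refine ⟨hf.smul, fun x => by simp [hf'], ?_⟩
    simp only [torusMean, ContinuousMap.smul_apply, smul_eq_mul] at *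
    rw [intervalIntegral.integral_const_mul, mul_left_comm, hf'', mul_zero]

/-- The space `𝒳^β` of even, zero-mean, `β`-Hölder continuous real functions on `𝕋`,
to be normed by `‖f‖ = sup |f| + sup_{x ≠ y} |f x - f y| / |x - y| ^ β`. -/
noncomputable def HolderEven (β : ℝ≥0) : Type := holderEvenSubmodule β

namespace HolderEven

variable {β : ℝ≥0}

noncomputable instance : AddCommGroup (HolderEven β) :=
  inferInstanceAs (AddCommGroup (holderEvenSubmodule β))

noncomputable instance : Module ℝ (HolderEven β) :=
  inferInstanceAs (Module ℝ (holderEvenSubmodule β))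

/-- The underlying continuous function. -/
noncomputable def toCont (f : HolderEven β) : C(Torus, ℝ) := Subtype.val f

noncomputable instance : CoeFun (HolderEven β) (fun _ => Torus → ℝ) := ⟨fun f => f.toCont⟩

lemma memHolder (f : HolderEven β) : MemHolder β f.toCont := f.2.1

noncomputable instance : Norm (HolderEven β) :=
  ⟨fun f => ‖f.toCont‖ + (nnHolderNorm β f.toCont : ℝ)⟩

lemma norm_def (f : HolderEven β) :
    ‖f‖ = ‖f.toCont‖ + (nnHolderNorm β f.toCont : ℝ) := rfl

lemma normCore : NormedSpace.Core ℝ (HolderEven β) where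
  norm_nonneg f := by rw [norm_def]; positivity
  norm_smul a f := by
    have h1 : (a • f).toCont = a • f.toCont := rfl
    have h2 := f.memHolder.nnHolderNorm_smul a
    rw [norm_def, norm_def, h1, norm_smul, mul_add, ContinuousMap.coe_smul, h2]
    simp
  norm_triangle f g := by
    have h1 : (f + g).toCont = f.toCont + g.toCont := rfl
    have h2 := f.memHolder.nnHolderNorm_add_le g.memHolder
    have h3 := norm_add_le f.toCont g.toCont
    have h4 : (nnHolderNorm β (f.toCont + g.toCont : Torus → ℝ) : ℝ)
        ≤ nnHolderNorm β f.toCont + nnHolderNorm β g.toCont := by exact_mod_cast h2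
    rw [norm_def, norm_def, norm_def, h1, ContinuousMap.coe_add]
    linarith
  norm_eq_zero_iff f := by
    constructor
    · intro h
      rw [norm_def] at h
      have h1 : ‖f.toCont‖ = 0 := by
        have := norm_nonneg f.toCont
        have := (nnHolderNorm β f.toCont).coe_nonneg
        linarith
      exact Subtype.ext (norm_eq_zero.1 h1)
    · rintro rfl
      have h1 : (0 : HolderEven β).toCont = 0 := rfl
      rw [norm_def, h1, norm_zero, ContinuousMap.coe_zero, nnHolderNorm_zero]
      simp

noncomputable instance : NormedAddCommGroup (HolderEven β) := NormedAddCommGroup.ofCore normCore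

noncomputable instance : NormedSpace ℝ (HolderEven β) := NormedSpace.ofCore normCore

end HolderEven

/-! ### The operator `|D|^{-α}` and the steady equation -/

/-- `v = |D|^{-α} u` on zero-mean functions: `v` has zero mean and its Fourier coefficients are
`v̂(m) = |m|^{-α} û(m)` for `m ≠ 0`. For continuous `v` this determines `v`. -/
def IsAbsDNegPow (α : ℝ) (u v : Torus → ℝ) : Prop :=
  ∀ m : ℤ, fourierCoeff (fun x => (v x : ℂ)) m =
    if m = 0 then 0 else (((|(m : ℝ)|) ^ (-α) : ℝ) : ℂ) * fourierCoeff (fun x => (u x : ℂ)) m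

/-- A continuous function is determined by its Fourier coefficients, hence so is `|D|^{-α} u`. -/
lemma IsAbsDNegPow.unique {α : ℝ} {u : Torus → ℝ} {v w : C(Torus, ℝ)}
    (hv : IsAbsDNegPow α u v) (hw : IsAbsDNegPow α u w) : v = w := by
  let V : C(Torus, ℂ) := ⟨fun x => (v x : ℂ), by fun_prop⟩
  let W : C(Torus, ℂ) := ⟨fun x => (w x : ℂ), by fun_prop⟩
  have hco : ∀ m, fourierCoeff V m = fourierCoeff W m := fun m => (hv m).trans (hw m).symm
  have hVW : V = W := by
    apply ContinuousMap.toLp_injective (p := 2) (𝕜 := ℂ) AddCircle.haarAddCircle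
    apply fourierBasis.repr.injective
    ext m
    rw [fourierBasis_repr, fourierBasis_repr, fourierCoeff_toLp, fourierCoeff_toLp]
    exact hco m
  ext x
  exact Complex.ofReal_injective (DFunLike.congr_fun hVW x)

/-- `φ` solves `|D|^{-α} φ = c φ - φ ^ p + ⨍ φ ^ p`, the steady equation for travelling waves
of speed `c` with nonlinearity `n(x) = x ^ p`. -/
def IsSteadySolution (α : ℝ) (p : ℕ) (φ : Torus → ℝ) (c : ℝ) : Prop :=
  IsAbsDNegPow α φ (fun x => c * φ x - φ x ^ p + torusMean (fun y => φ y ^ p))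

/-- `s ↦ (φ s, c s)` is (near `s = 0`) a local, analytic curve in `𝒳^β × ℝ` of nontrivial
`2π/k`-periodic solutions of the steady equation, which bifurcates from the line of trivial
solutions at `(0, k^{-α})` and comprises all nontrivial solutions near that point. -/
structure IsLocalBifurcationCurve (α : ℝ) (p k : ℕ) {β : ℝ≥0}
    (φ : ℝ → HolderEven β) (c : ℝ → ℝ) : Prop where
  analytic : AnalyticAt ℝ (fun s => (φ s, c s)) 0
  start_fst : φ 0 = 0
  start_snd : c 0 = (k : ℝ) ^ (-α)
  solution : ∀ᶠ s in 𝓝 (0 : ℝ), IsSteadySolution α p (φ s) (c s)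
  nontrivial : ∀ᶠ s in 𝓝[≠] (0 : ℝ), φ s ≠ 0
  periodic : ∀ᶠ s in 𝓝 (0 : ℝ), Function.Periodic (fun x : ℝ => φ s (x : Torus)) (2 * π / k)
  exhaustive : ∀ δ > 0, ∀ᶠ q : HolderEven β × ℝ in 𝓝 (0, (k : ℝ) ^ (-α)),
    q.1 ≠ 0 → IsSteadySolution α p q.1 q.2 → ∃ s ∈ Set.Ioo (-δ) δ, q = (φ s, c s)

/-! ### The explicit coefficients -/

/-- `C_{k,j} = (binom(p, j) / 2^{p-1}) / (k^{-α} - ((p - 2j) k)^{-α})`. -/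
noncomputable def coeffC (α : ℝ) (p k j : ℕ) : ℝ :=
  ((p.choose j : ℝ) / 2 ^ (p - 1)) / ((k : ℝ) ^ (-α) - (((p : ℝ) - 2 * j) * k) ^ (-α))

/-- `Φ_{k,j}(x) = C_{k,j} cos ((p - 2j) k x)`. -/
noncomputable def phiTerm (α : ℝ) (p k j : ℕ) (x : ℝ) : ℝ :=
  coeffC α p k j * cos (((p : ℝ) - 2 * j) * k * x)

/-- The second profile for even `p`: the sum over `0 ≤ j ≤ p/2 - 1`. -/
noncomputable def phiEven (α : ℝ) (p k : ℕ) (x : ℝ) : ℝ :=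
  ∑ j ∈ Finset.range (p / 2), phiTerm α p k j x

/-- The second profile for odd `p`: the sum over `0 ≤ j ≤ (p - 3)/2`. -/
noncomputable def phiOdd (α : ℝ) (p k : ℕ) (x : ℝ) : ℝ :=
  ∑ j ∈ Finset.range ((p - 1) / 2), phiTerm α p k j x

/-- The speed coefficient for even `p`; the sum is over `1 ≤ j ≤ p/2 - 1`. -/
noncomputable def speedEven (α : ℝ) (p k : ℕ) : ℝ :=
  (p : ℝ) / 2 ^ (p - 1) * (coeffC α p k 0 + ∑ j ∈ Finset.Ico 1 (p / 2),
    (((p - 1).choose j : ℝ) + ((p - 1).choose (j - 1) : ℝ)) * coeffC α p k j)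

/-- The speed coefficient for odd `p`. -/
noncomputable def speedOdd (p : ℕ) : ℝ :=
  1 / 2 ^ (p - 1) * (p.choose ((p - 1) / 2) : ℝ)

end NegDispersion

open NegDispersion

/-! The proof is a Lyapunov–Schmidt reduction after a rescaling. Write e = cos kx, let N(φ) be φ^p
minus its mean, and let subscripts denote cosine coefficients. The equation reads (c - m^{-α}) φ_m =
N(φ)_m for m ≠ 0 (`isSteadySolution_iff`). Put φ = s(e + w) with w_k = 0. Since N is homogeneous of
degree p, mode k gives c = k^{-α} + s^{p-1} N(e + w)_k. The other modes become w = t H(w) with t =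
s^{p-1} and H(w) = S(N(e + w) - N(e + w)_k w), where S inverts k^{-α} - |D|^{-α} off mode k
(`reducedMap`). The implicit function theorem gives a unique small analytic solution w(t)
(`exists_fixedPoint_branch`), and an a priori estimate shows that every nontrivial solution near the
bifurcation point has this form with w small (`eventually_normalForm`). This yields existence and
exhaustion, and it also puts any given curve in normal form
(`IsLocalBifurcationCurve.exists_normalForm`).

The analytic input is that S is bounded on 𝒳^β (`exists_partialInverse`). Fejér means are
contractions there, and an eventually convex null sequence is an absolutely convergent combination
of Fejér multipliers (`exists_multiplier`); the symbol of S minus its limit is such a sequence.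

For the expansions, w = t H(0) + O(t²), with H(0) read off from the Fourier expansion of cos^p, so φ
= s e + s^p H(0) + O(s^{2p-1}). For odd p, N(e)_k is the leading speed coefficient. For even p it
vanishes and the linear term p (e^{p-1} w)_k takes over, at first with error O(s^{2p-1}); evenness
of c improves this to O(s^{2p}) (`isBigO_pow_of_even`). Evenness holds because translation by π/k
preserves the equation and the speed and reverses the sign of mode k
(`IsLocalBifurcationCurve.speed_even`). -/

namespace NegDispersion

/-! ### Pointwise and Hölder estimates in 𝒳^β. -/

namespace HolderEven

variable {β : ℝ≥0}

@[simp] lemma toCont_zero : (0 : HolderEven β).toCont = 0 := rfl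

@[simp] lemma toCont_add (f g : HolderEven β) : (f + g).toCont = f.toCont + g.toCont := rfl

@[simp] lemma toCont_sub (f g : HolderEven β) : (f - g).toCont = f.toCont - g.toCont := rfl

@[simp] lemma toCont_smul (a : ℝ) (f : HolderEven β) : (a • f).toCont = a • f.toCont := rfl

lemma toCont_injective : Function.Injective (toCont : HolderEven β → C(Torus, ℝ)) :=
  Subtype.val_injective

lemma even (f : HolderEven β) (x : Torus) : f (-x) = f x := f.2.2.1 x

lemma mean_eq_zero (f : HolderEven β) : torusMean f = 0 := f.2.2.2

lemma abs_apply_le (f : HolderEven β) (x : Torus) : |f x| ≤ ‖f.toCont‖ :=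
  f.toCont.norm_coe_le_norm x

lemma norm_toCont_le (f : HolderEven β) : ‖f.toCont‖ ≤ ‖f‖ := by
  rw [norm_def]; exact le_add_of_nonneg_right (NNReal.coe_nonneg _)

lemma abs_apply_le_norm (f : HolderEven β) (x : Torus) : |f x| ≤ ‖f‖ :=
  (f.abs_apply_le x).trans f.norm_toCont_le

lemma abs_sub_le (f : HolderEven β) (x y : Torus) :
    |f x - f y| ≤ nnHolderNorm β f.toCont * dist x y ^ (β : ℝ) :=
  f.memHolder.holderWith.dist_le x y

lemma abs_sub_le_norm (f : HolderEven β) (x y : Torus) :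
    |f x - f y| ≤ ‖f‖ * dist x y ^ (β : ℝ) := by
  refine (f.abs_sub_le x y).trans ?_
  gcongr
  rw [norm_def]; exact le_add_of_nonneg_left (norm_nonneg _)

lemma holderWith_of_abs_sub_le {f : Torus → ℝ} {b : ℝ} (hb : 0 ≤ b)
    (h : ∀ x y, |f x - f y| ≤ b * dist x y ^ (β : ℝ)) : HolderWith b.toNNReal β f := by
  intro x y
  rw [edist_dist, edist_dist, ENNReal.ofReal_rpow_of_nonneg dist_nonneg β.coe_nonneg,
    ← ENNReal.ofReal, ← ENNReal.ofReal_mul hb]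
  exact ENNReal.ofReal_le_ofReal (h x y)

lemma norm_le_add (f : HolderEven β) {a b : ℝ} (ha : 0 ≤ a) (hb : 0 ≤ b)
    (h1 : ∀ x, |f x| ≤ a) (h2 : ∀ x y, |f x - f y| ≤ b * dist x y ^ (β : ℝ)) :
    ‖f‖ ≤ a + b := by
  rw [norm_def]
  have h3 := (holderWith_of_abs_sub_le hb h2).nnholderNorm_le
  refine add_le_add ((ContinuousMap.norm_le _ ha).2 h1) ?_
  rw [← NNReal.coe_le_coe, Real.coe_toNNReal b hb] at h3
  exact h3

/-- A member of the submodule as an element of `𝒳^β`. -/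
noncomputable def ofMem (f : C(Torus, ℝ)) (h : f ∈ holderEvenSubmodule β) : HolderEven β := ⟨f, h⟩

/-- Build an element of `𝒳^β` from a real Hölder estimate. -/
noncomputable def ofEstimate (f : C(Torus, ℝ)) (b : ℝ) (hb : 0 ≤ b)
    (h : ∀ x y, |f x - f y| ≤ b * dist x y ^ (β : ℝ)) (he : ∀ x, f (-x) = f x)
    (hm : torusMean f = 0) : HolderEven β :=
  ⟨f, (holderWith_of_abs_sub_le hb h).memHolder, he, hm⟩

end HolderEven

/-! ### Means and cosine coefficients of continuous functions -/

lemma continuous_coe_torus (f : C(Torus, ℝ)) : Continuous fun x : ℝ => f (x : Torus) :=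
  f.continuous.comp (AddCircle.continuous_mk' (2 * π))

lemma intervalIntegrable_mul_cos (f : C(Torus, ℝ)) (m : ℕ) (a b : ℝ) :
    IntervalIntegrable (fun x : ℝ => f (x : Torus) * cos (m * x)) MeasureTheory.volume a b :=
  ((continuous_coe_torus f).mul (by fun_prop)).intervalIntegrable a b

lemma cosCoeff_add (m : ℕ) (f g : C(Torus, ℝ)) :
    cosCoeff m (f + g : C(Torus, ℝ)) = cosCoeff m f + cosCoeff m g := by
  simp only [cosCoeff, ContinuousMap.add_apply, add_mul]
  rw [intervalIntegral.integral_add (intervalIntegrable_mul_cos f m _ _)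
    (intervalIntegrable_mul_cos g m _ _), mul_add]

lemma cosCoeff_smul (m : ℕ) (a : ℝ) (f : C(Torus, ℝ)) :
    cosCoeff m (a • f : C(Torus, ℝ)) = a * cosCoeff m f := by
  simp only [cosCoeff, ContinuousMap.smul_apply, smul_eq_mul, mul_assoc]
  rw [intervalIntegral.integral_const_mul, mul_left_comm]

lemma abs_cosCoeff_le (m : ℕ) (f : C(Torus, ℝ)) : |cosCoeff m f| ≤ 2 * ‖f‖ := by
  have h := intervalIntegral.norm_integral_le_of_norm_le_const (a := -π) (b := π) (C := ‖f‖)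
    (f := fun x : ℝ => f (x : Torus) * cos (m * x)) (fun x _ => by
      rw [norm_mul]
      have h1 := f.norm_coe_le_norm (x : Torus)
      have h2 : ‖cos (m * x)‖ ≤ 1 := abs_cos_le_one _
      nlinarith [norm_nonneg (f (x : Torus)), norm_nonneg (cos (m * x))])
  rw [cosCoeff, abs_mul, abs_of_pos (by positivity)]
  rw [Real.norm_eq_abs, sub_neg_eq_add, abs_of_pos (a := π + π) (by positivity)] at h
  calc 1 / π * |∫ x in (-π)..π, f (x : Torus) * cos (m * x)| ≤ 1 / π * (‖f‖ * (π + π)) := by gcongr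
    _ = 2 * ‖f‖ := by field_simp; ring

/-- The `m`-th cosine coefficient as a continuous functional on `C(𝕋)`. -/
noncomputable def cosCoeffC (m : ℕ) : C(Torus, ℝ) →L[ℝ] ℝ :=
  LinearMap.mkContinuous
    { toFun := fun f => cosCoeff m f
      map_add' := cosCoeff_add m
      map_smul' := fun a f => cosCoeff_smul m a f } 2 (abs_cosCoeff_le m)

lemma cosCoeffC_apply (m : ℕ) (f : C(Torus, ℝ)) : cosCoeffC m f = cosCoeff m f := rfl

lemma torusMean_eq_cosCoeff (u : Torus → ℝ) : torusMean u = cosCoeff 0 u / 2 := by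
  simp only [torusMean, cosCoeff, Nat.cast_zero, zero_mul, cos_zero, mul_one]
  field_simp

/-! ### Coefficient functionals and completeness of 𝒳^β. -/

namespace HolderEven

variable {β : ℝ≥0}

/-- The inclusion of `𝒳^β` in `C(𝕋)`. -/
noncomputable def toContL : HolderEven β →L[ℝ] C(Torus, ℝ) :=
  LinearMap.mkContinuous
    { toFun := toCont
      map_add' := fun _ _ => rfl
      map_smul' := fun _ _ => rfl } 1 (fun f => (f.norm_toCont_le).trans_eq (one_mul _).symm)

lemma toCont_sum {ι : Type*} (s : Finset ι) (f : ι → HolderEven β) :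
    (∑ i ∈ s, f i).toCont = ∑ i ∈ s, (f i).toCont := map_sum toContL f s

/-- The `m`-th cosine coefficient as a continuous functional on `𝒳^β`. -/
noncomputable def coeffL (m : ℕ) : HolderEven β →L[ℝ] ℝ := (cosCoeffC m).comp toContL

lemma coeffL_apply (m : ℕ) (f : HolderEven β) : coeffL m f = cosCoeff m f.toCont := rfl

lemma coeffL_zero (f : HolderEven β) : coeffL 0 f = 0 := by
  have h := f.mean_eq_zero
  rw [torusMean_eq_cosCoeff] at h
  rw [coeffL_apply]; linarith

/-- For an absolutely convergent series, the sup and the Hölder quotient of each tail are bounded by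
the tail of the norms. Hence the uniform limit lies in the space and is the limit in its norm. -/
instance : CompleteSpace (HolderEven β) := by
  refine NormedAddCommGroup.completeSpace_of_summable_imp_tendsto fun u hu => ?_
  have hu' : Summable fun n => (u n).toCont :=
    Summable.of_norm_bounded hu fun n => (u n).norm_toCont_le
  have hpt : ∀ x, HasSum (fun n => u n x) ((∑' n, (u n).toCont) x) := fun x =>
    (ContinuousMap.evalCLM ℝ x).hasSum hu'.hasSum
  have tail : ∀ (N : ℕ) (x : Torus), HasSum (fun n => u (n + N) x)
      ((∑' n, (u n).toCont) x - (∑ i ∈ Finset.range N, u i).toCont x) := fun N x => by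
    have := (hasSum_nat_add_iff' N).2 (hpt x)
    rwa [toCont_sum, ContinuousMap.sum_apply]
  have hN : ∀ N, Summable fun n => ‖u (n + N)‖ := fun N => (summable_nat_add_iff N).2 hu
  have est : ∀ (N : ℕ) (x y : Torus), |((∑' n, (u n).toCont) x
      - (∑ i ∈ Finset.range N, u i).toCont x) - ((∑' n, (u n).toCont) y
      - (∑ i ∈ Finset.range N, u i).toCont y)| ≤ (∑' n, ‖u (n + N)‖) * dist x y ^ (β : ℝ) := by
    intro N x y
    rw [← ((tail N x).sub (tail N y)).tsum_eq, ← (hN N).tsum_mul_right]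
    exact tsum_of_norm_bounded (f := fun n => u (n + N) x - u (n + N) y)
      ((hN N).mul_right _).hasSum fun n => (u (n + N)).abs_sub_le_norm x y
  have est0 : ∀ (N : ℕ) (x : Torus), |(∑' n, (u n).toCont) x
      - (∑ i ∈ Finset.range N, u i).toCont x| ≤ ∑' n, ‖u (n + N)‖ := by
    intro N x
    rw [← (tail N x).tsum_eq]
    exact tsum_of_norm_bounded (f := fun n => u (n + N) x)
      (hN N).hasSum fun n => (u (n + N)).abs_apply_le_norm x
  have hpos : ∀ N, 0 ≤ ∑' n, ‖u (n + N)‖ := fun N => tsum_nonneg fun _ => norm_nonneg _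
  have hmean : torusMean (∑' n, (u n).toCont : C(Torus, ℝ)) = 0 := by
    rw [torusMean_eq_cosCoeff, ← cosCoeffC_apply, (cosCoeffC 0).map_tsum hu']
    have : ∀ n, cosCoeffC 0 (u n).toCont = 0 := fun n => coeffL_zero (u n)
    simp [this]
  -- The tail estimate with N = 0 supplies the Hölder constant of the limit.
  refine ⟨ofEstimate (∑' n, (u n).toCont) (∑' n, ‖u (n + 0)‖) (hpos 0)
    (fun x y => by simpa using est 0 x y) (fun x => ?_) hmean, ?_⟩
  · refine (hpt (-x)).unique ?_
    simpa only [even] using hpt x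
  · rw [tendsto_iff_norm_sub_tendsto_zero]
    have hlim : Tendsto (fun N => (∑' n, ‖u (n + N)‖) + ∑' n, ‖u (n + N)‖) atTop (𝓝 0) := by
      have := tendsto_sum_nat_add fun n => ‖u n‖
      simpa using this.add this
    refine squeeze_zero (fun _ => norm_nonneg _) (fun N => ?_) hlim
    rw [norm_sub_rev]
    exact norm_le_add _ (hpos N) (hpos N) (est0 N) (est N)

end HolderEven

/-! ### Fourier coefficients of even functions -/

lemma integral_mul_sin_eq_zero {u : ℝ → ℝ} (hu : ∀ x, u (-x) = u x) (a : ℝ) :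
    ∫ x in (-π)..π, u x * sin (a * x) = 0 := by
  have h := intervalIntegral.integral_comp_neg (a := -π) (b := π) fun x => u x * sin (a * x)
  simp only [hu, mul_neg, sin_neg, neg_neg, intervalIntegral.integral_neg] at h
  linarith

/-- The sine part integrates to zero by parity; the factor 1/2 reconciles the normalisations 1/2π
and 1/π. -/
lemma fourierCoeff_ofReal (u : C(Torus, ℝ)) (hu : ∀ x, u (-x) = u x) (m : ℤ) :
    fourierCoeff (fun x => (u x : ℂ)) m = ((cosCoeff m.natAbs u / 2 : ℝ) : ℂ) := by
  have hcont := continuous_coe_torus u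
  rw [fourierCoeff_eq_intervalIntegral _ m (-π), show -π + 2 * π = π by ring]
  have hcos : ∀ x : ℝ, cos ((m.natAbs : ℝ) * x) = cos (m * x) := fun x => by
    rcases Int.natAbs_eq m with h | h
    · conv_rhs => rw [h]
      simp
    · conv_rhs => rw [h]
      simp
  have hpt : ∀ x : ℝ, fourier (-m) (x : Torus) • (u (x : Torus) : ℂ) =
      ((u (x : Torus) * cos (m * x) : ℝ) : ℂ)
        - Complex.I * ((u (x : Torus) * sin (m * x) : ℝ) : ℂ) := fun x => by
    rw [fourier_coe_apply, show 2 * (π : ℂ) * Complex.I * ((-m : ℤ) : ℂ) * x / ((2 * π : ℝ) : ℂ)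
      = ((-(m * x) : ℝ) : ℂ) * Complex.I by push_cast; field_simp]
    rw [Complex.exp_mul_I, ← Complex.ofReal_cos, ← Complex.ofReal_sin, cos_neg, sin_neg]
    simp only [smul_eq_mul]
    push_cast
    ring
  simp only [hpt]
  rw [intervalIntegral.integral_sub, intervalIntegral.integral_const_mul,
    intervalIntegral.integral_ofReal, intervalIntegral.integral_ofReal, integral_mul_sin_eq_zero]
  · simp only [cosCoeff, hcos]
    rw [← Complex.coe_smul]
    push_cast
    simp only [smul_eq_mul]
    field_simp
    simp
  · intro x
    have := hu (x : Torus)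
    simpa using this
  · exact (by fun_prop : Continuous fun x : ℝ => ((u (x : Torus) * cos (m * x) : ℝ) : ℂ)).intervalIntegrable _ _
  · exact (by fun_prop : Continuous fun x : ℝ => Complex.I * ((u (x : Torus) * sin (m * x) : ℝ) : ℂ)).intervalIntegrable _ _

/-- A continuous function is determined by its Fourier coefficients. -/
lemma eq_of_fourierCoeff_eq {u v : C(Torus, ℝ)}
    (h : ∀ m, fourierCoeff (fun x => (u x : ℂ)) m = fourierCoeff (fun x => (v x : ℂ)) m) :
    u = v := by
  let V : C(Torus, ℂ) := ⟨fun x => (u x : ℂ), by fun_prop⟩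
  let W : C(Torus, ℂ) := ⟨fun x => (v x : ℂ), by fun_prop⟩
  have hVW : V = W := by
    apply ContinuousMap.toLp_injective (p := 2) (𝕜 := ℂ) AddCircle.haarAddCircle
    apply fourierBasis.repr.injective
    ext m
    rw [fourierBasis_repr, fourierBasis_repr, fourierCoeff_toLp, fourierCoeff_toLp]
    exact h m
  ext x
  exact Complex.ofReal_injective (DFunLike.congr_fun hVW x)

/-- An even continuous function is determined by its cosine coefficients. -/
lemma eq_of_cosCoeff_eq {u v : C(Torus, ℝ)} (hu : ∀ x, u (-x) = u x) (hv : ∀ x, v (-x) = v x)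
    (h : ∀ m, cosCoeff m u = cosCoeff m v) : u = v :=
  eq_of_fourierCoeff_eq fun m => by
    rw [fourierCoeff_ofReal u hu m, fourierCoeff_ofReal v hv m, h]

/-- Mode 0 vanishes on 𝒳^β, so identities there can be checked on the nonzero modes alone. -/
lemma HolderEven.ext_coeffL {β : ℝ≥0} {f g : HolderEven β}
    (h : ∀ m ≠ 0, coeffL m f = coeffL m g) : f = g := by
  refine toCont_injective (eq_of_cosCoeff_eq f.even g.even fun m => ?_)
  rcases eq_or_ne m 0 with rfl | hm
  · exact (coeffL_zero f).trans (coeffL_zero g).symm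
  · exact h m hm

/-! ### Cosines -/

lemma integral_cos_int_mul (j : ℤ) :
    ∫ x in (-π)..π, cos (j * x) = if j = 0 then 2 * π else 0 := by
  split_ifs with h
  · subst h; simp; ring
  · have hj : (j : ℝ) ≠ 0 := by exact_mod_cast h
    rw [intervalIntegral.integral_comp_mul_left (fun x => cos x) hj, integral_cos]
    simp [sin_int_mul_pi]

lemma integral_cos_mul_cos (m n : ℕ) (hn : n ≠ 0) :
    ∫ x in (-π)..π, cos (m * x) * cos (n * x) = if m = n then π else 0 := by
  have hpt : ∀ x : ℝ, cos (m * x) * cos (n * x) =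
      (cos (((m - n : ℤ) : ℝ) * x) + cos (((m + n : ℤ) : ℝ) * x)) / 2 := fun x => by
    push_cast
    rw [sub_mul, add_mul, cos_sub, cos_add]; ring
  simp only [hpt]
  rw [intervalIntegral.integral_div, intervalIntegral.integral_add, integral_cos_int_mul,
    integral_cos_int_mul, if_neg (show (m + n : ℤ) ≠ 0 by omega)]
  · by_cases h : m = n
    · simp [h]
    · rw [if_neg (by omega), if_neg h]; simp
  · exact (by fun_prop : Continuous fun x : ℝ => cos (((m - n : ℤ) : ℝ) * x)).intervalIntegrable _ _
  · exact (by fun_prop : Continuous fun x : ℝ => cos (((m + n : ℤ) : ℝ) * x)).intervalIntegrable _ _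

/-- The function `cos (m x)` on the torus. -/
noncomputable def cosC (m : ℕ) : C(Torus, ℝ) :=
  ⟨fun x => (fourier (m : ℤ) x).re, by fun_prop⟩

@[simp] lemma cosC_coe (m : ℕ) (x : ℝ) : cosC m (x : Torus) = cos (m * x) := by
  simp only [cosC, ContinuousMap.coe_mk]
  rw [fourier_coe_apply, show 2 * (π : ℂ) * Complex.I * ((m : ℤ) : ℂ) * x / ((2 * π : ℝ) : ℂ)
      = ((m * x : ℝ) : ℂ) * Complex.I by push_cast; field_simp, Complex.exp_ofReal_mul_I_re]

lemma cosC_neg (m : ℕ) (x : Torus) : cosC m (-x) = cosC m x := by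
  induction x using QuotientAddGroup.induction_on with
  | H x =>
    have := cosC_coe m (-x)
    rw [mul_neg, cos_neg, ← cosC_coe] at this
    exact this

lemma exists_coe_eq_norm (a : Torus) : ∃ d : ℝ, (d : Torus) = a ∧ |d| = ‖a‖ := by
  induction a using QuotientAddGroup.induction_on with
  | H x =>
    refine ⟨x - round ((2 * π)⁻¹ * x) * (2 * π), ?_, (AddCircle.norm_eq (2 * π)).symm⟩
    rw [AddCircle.coe_sub, sub_eq_self, AddCircle.coe_eq_zero_iff]
    exact ⟨round ((2 * π)⁻¹ * x), by simp⟩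

lemma abs_cos_sub_cos_le (a b : ℝ) : |cos a - cos b| ≤ |a - b| := by
  have h := Real.lipschitzWith_cos.dist_le_mul a b
  simpa [Real.dist_eq] using h

lemma cosC_lipschitz (m : ℕ) (x y : Torus) : |cosC m x - cosC m y| ≤ m * dist x y := by
  obtain ⟨d, hd, hd'⟩ := exists_coe_eq_norm (x - y)
  induction y using QuotientAddGroup.induction_on with
  | H y =>
    have hx : x = ((d + y : ℝ) : Torus) := by
      rw [AddCircle.coe_add, hd]; exact (sub_add_cancel _ _).symm
    rw [dist_eq_norm, ← hd']
    rw [hx]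
    change |cosC m ((d + y : ℝ) : Torus) - cosC m (y : Torus)| ≤ _
    rw [cosC_coe, cosC_coe]
    refine (abs_cos_sub_cos_le _ _).trans (le_of_eq ?_)
    rw [mul_add, add_sub_cancel_right, abs_mul, abs_of_nonneg (Nat.cast_nonneg m)]

lemma dist_torus_le (x y : Torus) : dist x y ≤ π := by
  rw [dist_eq_norm]
  refine (AddCircle.norm_le_half_period (2 * π) two_pi_pos.ne').trans (le_of_eq ?_)
  rw [abs_of_pos two_pi_pos]; ring

/-- Split d = d^{1-β} d^β and use d ≤ π with π ≥ 1. This turns Lipschitz bounds into Hölder bounds.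
-/
lemma dist_le_rpow {β : ℝ≥0} (hβ : β ≤ 1) (x y : Torus) :
    dist x y ≤ π * dist x y ^ (β : ℝ) := by
  have hd := dist_torus_le x y
  have hβ' : (β : ℝ) ≤ 1 := by exact_mod_cast hβ
  rcases (dist_nonneg : 0 ≤ dist x y).eq_or_lt with h0 | h0
  · rw [← h0]; positivity
  · calc dist x y = dist x y ^ (1 - (β : ℝ)) * dist x y ^ (β : ℝ) := by
          rw [← rpow_add h0]; simp
      _ ≤ π * dist x y ^ (β : ℝ) := by
          gcongr
          calc dist x y ^ (1 - (β : ℝ)) ≤ π ^ (1 - (β : ℝ)) := by gcongr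
            _ ≤ π ^ (1 : ℝ) := by
                gcongr
                · exact one_le_two.trans two_le_pi
                · linarith [β.coe_nonneg]
            _ = π := rpow_one π

namespace HolderEven

variable {β : ℝ≥0}

/-- The function `cos (m x)` as an element of `𝒳^β`, for `m ≠ 0` and `β ≤ 1`. -/
noncomputable def cosine (β : ℝ≥0) (m : ℕ) : HolderEven β :=
  open Classical in
  if h : cosC m ∈ holderEvenSubmodule β then ofMem (cosC m) h else 0

lemma toCont_cosine (hβ : β ≤ 1) {m : ℕ} (hm : m ≠ 0) : (cosine β m).toCont = cosC m := by
  have h : cosC m ∈ holderEvenSubmodule β := by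
    refine ⟨(holderWith_of_abs_sub_le (b := m * π) (by positivity) fun x y => ?_).memHolder,
      cosC_neg m, ?_⟩
    · refine (cosC_lipschitz m x y).trans ?_
      rw [mul_assoc]
      gcongr
      exact dist_le_rpow hβ x y
    · simp only [torusMean, cosC_coe]
      have := integral_cos_int_mul m
      rw [if_neg (by exact_mod_cast hm)] at this
      rw [show ∫ x in (-π)..π, cos ((m : ℝ) * x) = 0 from by simpa using this, mul_zero]
  rw [cosine, dif_pos h]; rfl

lemma cosine_coe (hβ : β ≤ 1) {m : ℕ} (hm : m ≠ 0) (x : ℝ) :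
    cosine β m (x : Torus) = cos (m * x) := by
  rw [toCont_cosine hβ hm, cosC_coe]

lemma coeffL_cosine (hβ : β ≤ 1) {m : ℕ} (hm : m ≠ 0) (n : ℕ) :
    coeffL n (cosine β m) = if n = m then 1 else 0 := by
  rcases eq_or_ne n 0 with rfl | hn
  · rw [coeffL_zero, if_neg hm.symm]
  · rw [coeffL_apply, toCont_cosine hβ hm, cosCoeff]
    simp only [cosC_coe]
    rw [integral_cos_mul_cos m n hn]
    by_cases h : m = n
    · rw [if_pos h, if_pos h.symm]; field_simp
    · rw [if_neg h, if_neg (Ne.symm h), mul_zero]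

end HolderEven

/-! ### Fejér means -/

/-- The right side is |∑ e^{ijy}|², which is why the Fejér kernel is nonnegative. -/
lemma fejer_sum_eq (n : ℕ) (y : ℝ) :
    2 * ∑ j ∈ Finset.range n, ((n : ℝ) - j) * cos (j * y) - n =
      (∑ j ∈ Finset.range n, cos (j * y)) ^ 2 + (∑ j ∈ Finset.range n, sin (j * y)) ^ 2 := by
  induction n with
  | zero => simp
  | succ n ih =>
    have h1 : ∑ j ∈ Finset.range (n + 1), (((n + 1 : ℕ) : ℝ) - j) * cos (j * y) =
        ∑ j ∈ Finset.range n, ((n : ℝ) - j) * cos (j * y)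
          + ∑ j ∈ Finset.range (n + 1), cos (j * y) := by
      rw [← add_zero (∑ j ∈ Finset.range n, ((n : ℝ) - j) * cos (j * y)),
        ← show ((n : ℝ) - n) * cos (n * y) = 0 by ring,
        ← Finset.sum_range_succ fun j : ℕ => ((n : ℝ) - j) * cos (j * y), ← Finset.sum_add_distrib]
      refine Finset.sum_congr rfl fun j _ => ?_
      push_cast; ring
    -- Reverse the order of summation, j ↦ n - j, and apply the addition formula to cos((n - j)y).
    have h2 : ∑ j ∈ Finset.range n, cos (j * y) + cos (n * y) =
        cos (n * y) * ∑ j ∈ Finset.range n, cos (j * y)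
          + sin (n * y) * ∑ j ∈ Finset.range n, sin (j * y) + 1 := by
      rw [← Finset.sum_range_succ fun j : ℕ => cos (j * y), Finset.sum_range_succ',
        ← Finset.sum_range_reflect, Finset.mul_sum, Finset.mul_sum, ← Finset.sum_add_distrib]
      simp only [Nat.cast_zero, zero_mul, cos_zero]
      congr 1
      refine Finset.sum_congr rfl fun j hj => ?_
      have hj' := Finset.mem_range.1 hj
      rw [← cos_sub, show n - 1 - j + 1 = n - j by omega, Nat.cast_sub hj'.le]
      ring_nf
    rw [h1, Finset.sum_range_succ, Finset.sum_range_succ fun j : ℕ => sin (j * y)]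
    push_cast
    linear_combination ih + 2 * h2 - sin_sq_add_cos_sq ((n : ℝ) * y)

/-- The Fejér kernel, normalised to have integral one. -/
noncomputable def fejerKernel (n : ℕ) (y : ℝ) : ℝ :=
  1 / (2 * π) * (2 * ∑ j ∈ Finset.range n, (1 - (j : ℝ) / n) * cos (j * y) - 1)

lemma fejerKernel_nonneg {n : ℕ} (hn : n ≠ 0) (y : ℝ) : 0 ≤ fejerKernel n y := by
  have hn' : (0 : ℝ) < n := by positivity
  have h : 2 * ∑ j ∈ Finset.range n, (1 - (j : ℝ) / n) * cos (j * y) - 1 =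
      1 / n * (2 * ∑ j ∈ Finset.range n, ((n : ℝ) - j) * cos (j * y) - n) := by
    have h1 : ∑ j ∈ Finset.range n, (1 - (j : ℝ) / n) * cos (j * y) =
        1 / n * ∑ j ∈ Finset.range n, ((n : ℝ) - j) * cos (j * y) := by
      rw [Finset.mul_sum]
      refine Finset.sum_congr rfl fun j _ => ?_
      field_simp
    rw [h1]
    generalize ∑ j ∈ Finset.range n, ((n : ℝ) - j) * cos (j * y) = A
    field_simp
  rw [fejerKernel, h, fejer_sum_eq]
  positivity

lemma continuous_fejerKernel (n : ℕ) : Continuous (fejerKernel n) := by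
  unfold fejerKernel; fun_prop

lemma integral_fejerKernel_mul (n : ℕ) {g : ℝ → ℝ} (hg : Continuous g) :
    ∫ y in (-π)..π, fejerKernel n y * g y = 1 / (2 * π) *
      (2 * ∑ j ∈ Finset.range n, (1 - (j : ℝ) / n) * (∫ y in (-π)..π, cos (j * y) * g y)
        - ∫ y in (-π)..π, g y) := by
  have hpt : ∀ y, fejerKernel n y * g y = 1 / (2 * π) *
      (2 * ∑ j ∈ Finset.range n, (1 - (j : ℝ) / n) * (cos (j * y) * g y) - g y) := fun y => by
    simp only [fejerKernel, ← mul_assoc (1 - _ : ℝ), ← Finset.sum_mul]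
    ring
  simp only [hpt]
  rw [intervalIntegral.integral_const_mul, intervalIntegral.integral_sub,
    intervalIntegral.integral_const_mul, intervalIntegral.integral_finsetSum]
  · simp only [intervalIntegral.integral_const_mul]
  · intro j _
    exact (by fun_prop : Continuous fun y => (1 - (j : ℝ) / n) * (cos (j * y) * g y)).intervalIntegrable _ _
  · exact (by fun_prop : Continuous fun y =>
      2 * ∑ j ∈ Finset.range n, (1 - (j : ℝ) / n) * (cos (j * y) * g y)).intervalIntegrable _ _
  · exact hg.intervalIntegrable _ _

lemma integral_fejerKernel {n : ℕ} (hn : n ≠ 0) : ∫ y in (-π)..π, fejerKernel n y = 1 := by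
  have h := integral_fejerKernel_mul n (g := fun _ => 1) continuous_const
  simp only [mul_one] at h
  have h0 : ∀ j : ℕ, (1 - (j : ℝ) / n) * (∫ y in (-π)..π, cos (j * y)) =
      if j = 0 then 2 * π else 0 := fun j => by
    have := integral_cos_int_mul j
    simp only [Int.cast_natCast, Nat.cast_eq_zero] at this
    rw [this]
    split_ifs with hj
    · simp [hj]
    · simp
  simp only [h0] at h
  rw [h, Finset.sum_ite_eq' (Finset.range n) 0, if_pos (Finset.mem_range.2 (Nat.pos_of_ne_zero hn))]
  simp only [intervalIntegral.integral_const, smul_eq_mul]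
  field_simp
  ring

lemma abs_integral_fejerKernel_mul_le {n : ℕ} (hn : n ≠ 0) {g : ℝ → ℝ} (hg : Continuous g) {M : ℝ}
    (hM : ∀ y, |g y| ≤ M) : |∫ y in (-π)..π, fejerKernel n y * g y| ≤ M := by
  have hle : -π ≤ π := by linarith [pi_pos]
  have hc := continuous_fejerKernel n
  calc |∫ y in (-π)..π, fejerKernel n y * g y|
      ≤ ∫ y in (-π)..π, |fejerKernel n y * g y| :=
        intervalIntegral.abs_integral_le_integral_abs hle
    _ ≤ ∫ y in (-π)..π, fejerKernel n y * M := by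
        refine intervalIntegral.integral_mono_on hle
          ((by fun_prop : Continuous fun y => |fejerKernel n y * g y|).intervalIntegrable _ _)
          ((by fun_prop : Continuous fun y => fejerKernel n y * M).intervalIntegrable _ _) fun y _ => ?_
        rw [abs_mul, abs_of_nonneg (fejerKernel_nonneg hn y)]
        exact mul_le_mul_of_nonneg_left (hM y) (fejerKernel_nonneg hn y)
    _ = M := by rw [intervalIntegral.integral_mul_const, integral_fejerKernel hn, one_mul]

/-- Substitution and periodicity move the translation onto the cosine; the sine half of the addition
formula drops out because u is even. -/
lemma integral_cos_mul_comp_sub (u : C(Torus, ℝ)) (hu : ∀ x, u (-x) = u x) (j : ℕ) (x : ℝ) :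
    ∫ y in (-π)..π, cos (j * y) * u ((x - y : ℝ) : Torus) = π * (cosCoeff j u * cos (j * x)) := by
  have hc := continuous_coe_torus u
  have hper : Function.Periodic (fun y : ℝ => cos (j * (x - y)) * u (y : Torus)) (2 * π) := by
    intro y
    simp only
    rw [show (j : ℝ) * (x - (y + 2 * π)) = j * (x - y) - j * (2 * π) by ring,
      cos_sub_nat_mul_two_pi, AddCircle.coe_add, AddCircle.coe_period, add_zero]
  have h1 := intervalIntegral.integral_comp_sub_left (a := -π) (b := π)
    (fun y : ℝ => cos (j * (x - y)) * u (y : Torus)) x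
  have h2 := hper.intervalIntegral_add_eq (x - π) (-π)
  rw [show x - π + 2 * π = x - -π by ring, show -π + 2 * π = π by ring] at h2
  simp only [sub_sub_cancel] at h1
  rw [h1, h2]
  have hpt : ∀ y : ℝ, cos (j * (x - y)) * u (y : Torus) = cos (j * x) * (u (y : Torus) * cos (j * y))
      + sin (j * x) * (u (y : Torus) * sin (j * y)) := fun y => by
    rw [mul_sub, cos_sub]; ring
  simp only [hpt]
  rw [intervalIntegral.integral_add, intervalIntegral.integral_const_mul,
    intervalIntegral.integral_const_mul, integral_mul_sin_eq_zero, cosCoeff]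
  · field_simp; ring
  · intro y; simpa using hu (y : Torus)
  · exact (by fun_prop : Continuous fun y : ℝ =>
      cos (j * x) * (u (y : Torus) * cos (j * y))).intervalIntegrable _ _
  · exact (by fun_prop : Continuous fun y : ℝ =>
      sin (j * x) * (u (y : Torus) * sin (j * y))).intervalIntegrable _ _

namespace HolderEven

variable {β : ℝ≥0}

/-- The Fejér mean of order `n` as a linear map. -/
noncomputable def fejerLin (n : ℕ) : HolderEven β →ₗ[ℝ] HolderEven β :=
  ∑ j ∈ Finset.range n, (1 - (j : ℝ) / n) • ((coeffL j).smulRight (cosine β j)).toLinearMap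

lemma fejerLin_apply (n : ℕ) (f : HolderEven β) :
    fejerLin n f = ∑ j ∈ Finset.range n, (1 - (j : ℝ) / n) • coeffL j f • cosine β j := by
  simp [fejerLin]

lemma fejerLin_coe (hβ : β ≤ 1) (n : ℕ) (f : HolderEven β) (x : ℝ) :
    fejerLin n f (x : Torus) = ∫ y in (-π)..π, fejerKernel n y * f ((x - y : ℝ) : Torus) := by
  have hc : Continuous fun y : ℝ => f ((x - y : ℝ) : Torus) :=
    (continuous_coe_torus f.toCont).comp (continuous_const.sub continuous_id)
  rw [integral_fejerKernel_mul n hc]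
  simp only [integral_cos_mul_comp_sub f.toCont f.even]
  have h0 : ∫ y in (-π)..π, f ((x - y : ℝ) : Torus) = 0 := by
    have := integral_cos_mul_comp_sub f.toCont f.even 0 x
    rw [show cosCoeff 0 f.toCont = 0 from coeffL_zero f] at this
    simpa using this
  rw [h0, fejerLin_apply, toCont_sum, ContinuousMap.sum_apply, sub_zero, ← mul_assoc, Finset.mul_sum]
  refine Finset.sum_congr rfl fun j _ => ?_
  rcases eq_or_ne j 0 with rfl | hj
  · rw [coeffL_zero, show cosCoeff 0 f.toCont = 0 from coeffL_zero f]; simp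
  · simp only [toCont_smul, ContinuousMap.smul_apply, smul_eq_mul, cosine_coe hβ hj, coeffL_apply]
    field_simp

/-- Convolution with a probability density averages translates, so neither the sup norm nor the
Hölder seminorm can grow. -/
lemma norm_fejerLin_le (hβ : β ≤ 1) {n : ℕ} (hn : n ≠ 0) (f : HolderEven β) :
    ‖fejerLin n f‖ ≤ ‖f‖ := by
  have hc : ∀ x : ℝ, Continuous fun y : ℝ => f ((x - y : ℝ) : Torus) := fun x =>
    (continuous_coe_torus f.toCont).comp (continuous_const.sub continuous_id)
  rw [norm_def f]
  refine norm_le_add _ (norm_nonneg _) (NNReal.coe_nonneg _) (fun x => ?_) (fun x x' => ?_)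
  · induction x using QuotientAddGroup.induction_on with
    | H x =>
      rw [fejerLin_coe hβ]
      exact abs_integral_fejerKernel_mul_le hn (hc x) fun y => f.abs_apply_le _
  · induction x using QuotientAddGroup.induction_on with
    | H x =>
    induction x' using QuotientAddGroup.induction_on with
    | H x' =>
      have hi : ∀ x : ℝ, IntervalIntegrable (fun y : ℝ => fejerKernel n y * f ((x - y : ℝ) : Torus))
          MeasureTheory.volume (-π) π :=
        fun x => ((continuous_fejerKernel n).mul (hc x)).intervalIntegrable _ _
      rw [fejerLin_coe hβ, fejerLin_coe hβ, ← intervalIntegral.integral_sub (hi x) (hi x')]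
      simp only [← mul_sub]
      refine abs_integral_fejerKernel_mul_le hn ((hc x).sub (hc x')) fun y => ?_
      refine (f.abs_sub_le _ _).trans (le_of_eq ?_)
      rw [AddCircle.coe_sub, AddCircle.coe_sub, dist_sub_right]

/-- The Fejér mean of order `n` as a bounded operator on `𝒳^β`. -/
noncomputable def fejer (hβ : β ≤ 1) (n : ℕ) : HolderEven β →L[ℝ] HolderEven β :=
  -- The shift to n + 1 avoids the empty sum, for which the kernel is not a probability density.
  LinearMap.mkContinuous (fejerLin (n + 1)) 1
    fun f => (norm_fejerLin_le hβ n.succ_ne_zero f).trans_eq (one_mul _).symm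

lemma norm_fejer_le (hβ : β ≤ 1) (n : ℕ) : ‖fejer hβ n‖ ≤ 1 :=
  LinearMap.mkContinuous_norm_le _ zero_le_one _

lemma coeffL_fejer (hβ : β ≤ 1) (n : ℕ) (f : HolderEven β) (m : ℕ) :
    coeffL m (fejer hβ n f) = (if m < n + 1 then 1 - (m : ℝ) / (n + 1) else 0) * coeffL m f := by
  have h : fejer hβ n f = fejerLin (n + 1) f := rfl
  rw [h, fejerLin_apply, map_sum]
  have : ∀ j ∈ Finset.range (n + 1), coeffL m ((1 - (j : ℝ) / (n + 1 : ℕ)) • coeffL j f • cosine β j) =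
      if m = j then (1 - (m : ℝ) / (n + 1)) * coeffL m f else 0 := fun j _ => by
    rcases eq_or_ne j 0 with rfl | hj
    · rw [coeffL_zero f]
      split_ifs with hm
      · rw [hm, coeffL_zero f]; simp
      · simp
    · rw [map_smul, map_smul, coeffL_cosine hβ hj]
      split_ifs with hm
      · subst hm; simp
      · simp
  rw [Finset.sum_congr rfl this, Finset.sum_ite_eq]
  simp only [Finset.mem_range]
  split_ifs <;> simp

end HolderEven

/-! ### Eventually convex null sequences as Fourier multipliers -/

section Convex

variable {a : ℕ → ℝ}

/-- Second differences. -/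
def secondDiff (a : ℕ → ℝ) (n : ℕ) : ℝ := a n - 2 * a (n + 1) + a (n + 2)

/-- Summation by parts twice. It serves both the summability of the weights and the recovery of the
sequence from them. -/
lemma sum_secondDiff (a : ℕ → ℝ) (m N : ℕ) :
    ∑ n ∈ Finset.range N, ((n : ℝ) + 1) * secondDiff a (n + m) =
      a m - a (N + m) - N * (a (N + m) - a (N + m + 1)) := by
  induction N with
  | zero => simp
  | succ N ih =>
    rw [Finset.sum_range_succ, ih, secondDiff, show N + 1 + m = N + m + 1 by ring]
    push_cast; ring

/-- A convex null sequence is decreasing and nonnegative, so both boundary terms in `sum_secondDiff`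
have a favourable sign and the partial sums stay below `a 0`. -/
lemma summable_secondDiff_of_convex (ha : Tendsto a atTop (𝓝 0)) (hc : ∀ n, 0 ≤ secondDiff a n) :
    Summable fun n : ℕ => ((n : ℝ) + 1) * secondDiff a n := by
  have hd : Antitone fun n => a n - a (n + 1) := antitone_nat_of_succ_le fun n => by
    have := hc n; simp only [secondDiff] at this; linarith
  have hd0 : Tendsto (fun n => a n - a (n + 1)) atTop (𝓝 0) := by
    simpa using ha.sub (ha.comp (tendsto_add_atTop_nat 1))
  have hdn : ∀ n, 0 ≤ a n - a (n + 1) := fun n => hd.le_of_tendsto hd0 n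
  have han : ∀ n, 0 ≤ a n := fun n =>
    (antitone_nat_of_succ_le fun n => by linarith [hdn n] : Antitone a).le_of_tendsto ha n
  refine summable_of_sum_range_le (c := a 0) (fun n => mul_nonneg (by positivity) (hc n)) fun N => ?_
  have := sum_secondDiff a 0 N
  simp only [add_zero] at this
  rw [this]
  have := mul_nonneg (Nat.cast_nonneg N : (0 : ℝ) ≤ N) (hdn N)
  linarith [han N]

lemma summable_abs_secondDiff (ha : Tendsto a atTop (𝓝 0)) (hc : ∀ᶠ n in atTop, 0 ≤ secondDiff a n) :
    Summable fun n : ℕ => ((n : ℝ) + 1) * |secondDiff a n| := by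
  obtain ⟨N, hN⟩ := eventually_atTop.1 hc
  have hs : ∀ n, secondDiff (fun n => a (n + N)) n = secondDiff a (n + N) := fun n => by
    simp only [secondDiff]
    rw [show n + 1 + N = n + N + 1 by ring, show n + 2 + N = n + N + 2 by ring]
  have hpos : ∀ n, 0 ≤ secondDiff a (n + N) := fun n => hN _ (Nat.le_add_left _ _)
  have h1 := summable_secondDiff_of_convex (a := fun n => a (n + N))
    (ha.comp (tendsto_add_atTop_nat N)) (fun n => by rw [hs]; exact hpos n)
  simp only [hs] at h1
  rw [← summable_nat_add_iff N]
  -- The factor comes from n + N + 1 ≤ (N + 1)(n + 1).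
  refine Summable.of_nonneg_of_le (fun n => by positivity) (fun n => ?_) (h1.mul_left ((N : ℝ) + 1))
  rw [abs_of_nonneg (hpos n), ← mul_assoc]
  refine mul_le_mul_of_nonneg_right ?_ (hpos n)
  push_cast
  nlinarith [(Nat.cast_nonneg n : (0 : ℝ) ≤ n), (Nat.cast_nonneg N : (0 : ℝ) ≤ N),
    mul_nonneg (Nat.cast_nonneg n : (0 : ℝ) ≤ n) (Nat.cast_nonneg N : (0 : ℝ) ≤ N)]

/-- The difference at N is the sum of the second differences from N on, and there the weight n + 1
dominates N; so the tail of the summable series bounds the product. -/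
lemma tendsto_mul_diff (ha : Tendsto a atTop (𝓝 0))
    (hs : Summable fun n : ℕ => ((n : ℝ) + 1) * |secondDiff a n|) :
    Tendsto (fun n : ℕ => (n : ℝ) * (a n - a (n + 1))) atTop (𝓝 0) := by
  have hd0 : Tendsto (fun n => a n - a (n + 1)) atTop (𝓝 0) := by
    simpa using ha.sub (ha.comp (tendsto_add_atTop_nat 1))
  refine squeeze_zero_norm (fun N => ?_)
    (tendsto_sum_nat_add fun n : ℕ => ((n : ℝ) + 1) * |secondDiff a n|)
  have hsN := (summable_nat_add_iff N).2 hs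
  have htel : ∀ M, ∑ n ∈ Finset.range M, secondDiff a (n + N) =
      (a N - a (N + 1)) - (a (M + N) - a (M + N + 1)) := fun M => by
    induction M with
    | zero => simp
    | succ M ih => rw [Finset.sum_range_succ, ih, secondDiff, show M + 1 + N = M + N + 1 by ring]; ring
  have hlim : Tendsto (fun M => (N : ℝ) * ∑ n ∈ Finset.range M, secondDiff a (n + N)) atTop
      (𝓝 (N * (a N - a (N + 1)))) := by
    simp only [htel]
    refine Tendsto.const_mul _ ?_
    simpa using tendsto_const_nhds.sub (hd0.comp (tendsto_add_atTop_nat N))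
  refine le_of_tendsto hlim.norm (Eventually.of_forall fun M => ?_)
  rw [Finset.mul_sum]
  refine (norm_sum_le _ _).trans ((Finset.sum_le_sum fun n _ => ?_).trans
    (hsN.sum_le_tsum (Finset.range M) fun n _ => by positivity))
  rw [norm_mul, Real.norm_eq_abs, Real.norm_eq_abs, Nat.abs_cast]
  gcongr
  push_cast
  linarith [(Nat.cast_nonneg n : (0 : ℝ) ≤ n)]

/-- The sequence is a superposition of the triangular Fejér symbols. The terms n < m vanish, and the
boundary terms of the summation by parts tend to zero. -/
lemma hasSum_secondDiff (ha : Tendsto a atTop (𝓝 0))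
    (hs : Summable fun n : ℕ => ((n : ℝ) + 1) * |secondDiff a n|) (m : ℕ) :
    HasSum (fun n : ℕ => ((n : ℝ) + 1) * secondDiff a n *
      (if m < n + 1 then 1 - (m : ℝ) / (n + 1) else 0)) (a m) := by
  have hsum : Summable (fun n : ℕ => ((n : ℝ) + 1) * secondDiff a n *
      (if m < n + 1 then 1 - (m : ℝ) / (n + 1) else 0)) := by
    refine Summable.of_norm_bounded hs fun n => ?_
    rw [norm_mul, norm_mul, Real.norm_eq_abs, Real.norm_eq_abs, abs_of_pos (by positivity)]
    refine mul_le_of_le_one_right (by positivity) ?_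
    split_ifs with h
    · have h1 : (m : ℝ) < n + 1 := by exact_mod_cast h
      have h2 : (m : ℝ) / (n + 1) ≤ 1 := (div_le_one (by positivity)).2 h1.le
      have h3 : 0 ≤ (m : ℝ) / (n + 1) := by positivity
      rw [Real.norm_eq_abs, abs_le]; constructor <;> linarith
    · simp
  have h0 : ∑ n ∈ Finset.range m, ((n : ℝ) + 1) * secondDiff a n *
      (if m < n + 1 then 1 - (m : ℝ) / (n + 1) else 0) = 0 :=
    Finset.sum_eq_zero fun n hn => by
      rw [if_neg (by have := Finset.mem_range.1 hn; omega), mul_zero]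
  rw [← hasSum_nat_add_iff' m, h0, sub_zero]
  have hs' := (summable_nat_add_iff m).2 hsum
  refine (hs'.hasSum_iff_tendsto_nat).2 ?_
  -- Here (n + m + 1)(1 - m/(n + m + 1)) = n + 1, the weight in `sum_secondDiff`.
  have hpt : ∀ N, ∑ n ∈ Finset.range N, (((n + m : ℕ) : ℝ) + 1) * secondDiff a (n + m) *
      (if m < n + m + 1 then 1 - (m : ℝ) / (((n + m : ℕ) : ℝ) + 1) else 0) =
      a m - a (N + m) - N * (a (N + m) - a (N + m + 1)) := fun N => by
    rw [← sum_secondDiff]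
    refine Finset.sum_congr rfl fun n _ => ?_
    rw [if_pos (by omega)]
    push_cast
    field_simp
    ring
  refine Tendsto.congr (fun N => (hpt N).symm) ?_
  have h1 := (tendsto_mul_diff ha hs).comp (tendsto_add_atTop_nat m)
  have hd0 : Tendsto (fun n => a n - a (n + 1)) atTop (𝓝 0) := by
    simpa using ha.sub (ha.comp (tendsto_add_atTop_nat 1))
  have h2 := (hd0.comp (tendsto_add_atTop_nat m)).const_mul (m : ℝ)
  have h3 := ha.comp (tendsto_add_atTop_nat m)
  have h4 := (tendsto_const_nhds (x := a m)).sub h3 |>.sub (h1.sub h2)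
  simp only [Function.comp_def, mul_zero, sub_zero] at h4
  refine h4.congr fun N => ?_
  push_cast; ring

/-- The superposition of Fejér means converges absolutely in operator norm, each mean having norm at
most one; its symbol is then read off mode by mode. -/
theorem HolderEven.exists_multiplier {β : ℝ≥0} (hβ : β ≤ 1) (ha : Tendsto a atTop (𝓝 0))
    (hc : ∀ᶠ n in atTop, 0 ≤ secondDiff a n) :
    ∃ S : HolderEven β →L[ℝ] HolderEven β, ∀ f m, coeffL m (S f) = a m * coeffL m f := by
  have hs := summable_abs_secondDiff ha hc
  have hsum : Summable fun n : ℕ => (((n : ℝ) + 1) * secondDiff a n) • fejer (β := β) hβ n := by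
    refine Summable.of_norm_bounded hs fun n => ?_
    rw [norm_smul, norm_mul, Real.norm_eq_abs, Real.norm_eq_abs, abs_of_pos (by positivity)]
    exact mul_le_of_le_one_right (by positivity) (norm_fejer_le hβ n)
  refine ⟨∑' n : ℕ, (((n : ℝ) + 1) * secondDiff a n) • fejer hβ n, fun f m => ?_⟩
  have h1 := ((coeffL m).comp (ContinuousLinearMap.apply ℝ (HolderEven β) f)).hasSum hsum.hasSum
  have h2 := (hasSum_secondDiff ha hs m).mul_right (coeffL m f)
  have h3 : ∀ n : ℕ, ((n : ℝ) + 1) * secondDiff a n *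
      (if m < n + 1 then 1 - (m : ℝ) / (n + 1) else 0) * coeffL m f =
      coeffL m ((((n : ℝ) + 1) * secondDiff a n) • fejer hβ n f) := fun n => by
    rw [map_smul, coeffL_fejer hβ, smul_eq_mul, mul_assoc]
  rw [funext h3] at h2
  exact h1.unique h2

end Convex

/-! ### The partial inverse of `k^{-α} - |D|^{-α}` -/

/-- From n(n + 2) ≤ (n + 1)² the middle value is at most the geometric mean of its neighbours, hence
at most their arithmetic mean. -/
lemma two_mul_rpow_neg_le (α : ℝ) (hα : 0 < α) {n : ℕ} (hn : n ≠ 0) :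
    2 * ((n + 1 : ℕ) : ℝ) ^ (-α) ≤ (n : ℝ) ^ (-α) + ((n + 2 : ℕ) : ℝ) ^ (-α) := by
  have h0 : (0 : ℝ) < n := by positivity
  have h1 : (((n + 1 : ℕ) : ℝ) ^ (-α)) ^ 2 ≤ (n : ℝ) ^ (-α) * ((n + 2 : ℕ) : ℝ) ^ (-α) := by
    rw [sq, ← mul_rpow (by positivity) (by positivity), ← mul_rpow (by positivity) (by positivity)]
    refine rpow_le_rpow_of_nonpos (by positivity) ?_ (by linarith)
    push_cast; nlinarith
  have h2 : 0 ≤ (n : ℝ) ^ (-α) := by positivity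
  have h3 : 0 ≤ ((n + 2 : ℕ) : ℝ) ^ (-α) := by positivity
  refine le_of_sq_le_sq ?_ (by positivity)
  nlinarith [sq_nonneg ((n : ℝ) ^ (-α) - ((n + 2 : ℕ) : ℝ) ^ (-α))]

/-- The symbol of the partial inverse of `k^{-α} - |D|^{-α}`. -/
noncomputable def invSymbol (α : ℝ) (k m : ℕ) : ℝ :=
  if m = k then 0 else 1 / ((k : ℝ) ^ (-α) - (m : ℝ) ^ (-α))

lemma rpow_neg_ne {α : ℝ} (hα : 0 < α) {k m : ℕ} (h : m ≠ k) :
    (k : ℝ) ^ (-α) - (m : ℝ) ^ (-α) ≠ 0 := by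
  intro h0
  have h1 := (rpow_left_inj (Nat.cast_nonneg k) (Nat.cast_nonneg m) (neg_ne_zero.2 hα.ne')).1
    (sub_eq_zero.1 h0)
  exact h (by exact_mod_cast h1.symm)

/-- Beyond k the symbol is the reciprocal of a positive concave sequence, hence convex. Its limit
1/λ, with λ = k^{-α}, is subtracted to get a null sequence and restored at the end as a multiple of
the identity. -/
theorem HolderEven.exists_partialInverse {β : ℝ≥0} (hβ : β ≤ 1) {α : ℝ} (hα : 0 < α) {k : ℕ}
    (hk : k ≠ 0) : ∃ S : HolderEven β →L[ℝ] HolderEven β, ∀ f m,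
      coeffL m (S f) = invSymbol α k m * coeffL m f := by
  set lam : ℝ := (k : ℝ) ^ (-α) with hlam
  have hlam0 : 0 < lam := by positivity
  have ht : Tendsto (fun m : ℕ => (m : ℝ) ^ (-α)) atTop (𝓝 0) :=
    (tendsto_rpow_neg_atTop hα).comp tendsto_natCast_atTop_atTop
  have hev : ∀ m, k < m → invSymbol α k m = 1 / (lam - (m : ℝ) ^ (-α)) ∧ 0 < lam - (m : ℝ) ^ (-α) :=
    fun m hm => ⟨by rw [invSymbol, if_neg hm.ne'], sub_pos.2 <|
      rpow_lt_rpow_of_neg (by positivity) (by exact_mod_cast hm) (by linarith)⟩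
  have hlim : Tendsto (fun m => invSymbol α k m - 1 / lam) atTop (𝓝 0) := by
    have h1 : Tendsto (fun m : ℕ => 1 / (lam - (m : ℝ) ^ (-α)) - 1 / lam) atTop (𝓝 0) := by
      have := ((tendsto_const_nhds (x := (1 : ℝ))).div ((tendsto_const_nhds (x := lam)).sub ht)
        (by simpa using hlam0.ne')).sub (tendsto_const_nhds (x := 1 / lam))
      simpa using this
    refine h1.congr' ?_
    filter_upwards [eventually_gt_atTop k] with m hm
    rw [(hev m hm).1]
  have hconv : ∀ᶠ m in atTop, 0 ≤ secondDiff (fun m => invSymbol α k m - 1 / lam) m := by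
    filter_upwards [eventually_gt_atTop k] with m hm
    obtain ⟨e0, p0⟩ := hev m hm
    obtain ⟨e1, p1⟩ := hev (m + 1) (by omega)
    obtain ⟨e2, p2⟩ := hev (m + 2) (by omega)
    simp only [secondDiff, e0, e1, e2]
    have hcv := two_mul_rpow_neg_le α hα (n := m) (by omega)
    set A := lam - (m : ℝ) ^ (-α)
    set B := lam - ((m + 2 : ℕ) : ℝ) ^ (-α)
    set C := lam - ((m + 1 : ℕ) : ℝ) ^ (-α)
    have hABC : A + B ≤ 2 * C := by simp only [A, B, C]; linarith
    -- Concavity bounds C below by (A + B)/2, and the harmonic–arithmetic mean inequality finishes.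
    have h2 : 2 * (1 / C) ≤ 1 / A + 1 / B := by
      calc 2 * (1 / C) = 4 / (2 * C) := by field_simp; norm_num
        _ ≤ 4 / (A + B) := by gcongr
        _ ≤ 1 / A + 1 / B := by
            rw [div_add_div _ _ p0.ne' p2.ne', div_le_div_iff₀ (by positivity) (by positivity)]
            nlinarith [sq_nonneg (A - B)]
    linarith

  obtain ⟨S, hS⟩ := exists_multiplier (β := β) hβ hlim hconv
  refine ⟨S + (1 / lam) • ContinuousLinearMap.id ℝ _, fun f m => ?_⟩
  simp [hS]; ring

/-! ### The nonlinearity -/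

/-- `F` is bounded by `a`, has `β`-Hölder constant `h`, and `a + h ≤ M`. -/
def HolderBound (β : ℝ≥0) (F : C(Torus, ℝ)) (M : ℝ) : Prop :=
  ∃ a h : ℝ, 0 ≤ a ∧ 0 ≤ h ∧ a + h ≤ M ∧ (∀ x, |F x| ≤ a) ∧
    ∀ x y, |F x - F y| ≤ h * dist x y ^ (β : ℝ)

section HolderBound

variable {β : ℝ≥0} {F G : C(Torus, ℝ)} {M M' : ℝ}

lemma HolderBound.nonneg (hF : HolderBound β F M) : 0 ≤ M := by
  obtain ⟨a, h, ha, hh, hM, -⟩ := hF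
  linarith

lemma holderBound_one : HolderBound β 1 1 :=
  ⟨1, 0, zero_le_one, le_rfl, by simp, by simp, by simp⟩

/-- The product has sup bound aa' and Hölder constant ah' + ha', whose sum is at most (a + h)(a' +
h'). -/
lemma HolderBound.mul (hF : HolderBound β F M) (hG : HolderBound β G M') :
    HolderBound β (F * G) (M * M') := by
  have hM'0 := hG.nonneg
  obtain ⟨a, h, ha, hh, hM, h1, h2⟩ := hF
  obtain ⟨a', h', ha', hh', hM', h1', h2'⟩ := hG
  refine ⟨a * a', a * h' + h * a', by positivity, by positivity, ?_, fun x => ?_, fun x y => ?_⟩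
  · calc a * a' + (a * h' + h * a') ≤ (a + h) * (a' + h') := by nlinarith [mul_nonneg hh hh']
      _ ≤ M * M' := by
        have hM0 : 0 ≤ M := by linarith
        gcongr
  · rw [ContinuousMap.mul_apply, abs_mul]
    exact mul_le_mul (h1 x) (h1' x) (abs_nonneg _) ha
  · simp only [ContinuousMap.mul_apply]
    rw [show F x * G x - F y * G y = F x * (G x - G y) + (F x - F y) * G y by ring, add_mul]
    refine (abs_add_le _ _).trans (add_le_add ?_ ?_)
    · rw [abs_mul, mul_assoc]
      exact mul_le_mul (h1 x) (h2' x y) (abs_nonneg _) ha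
    · rw [abs_mul, mul_right_comm]
      exact mul_le_mul (h2 x y) (h1' y) (abs_nonneg _) (by positivity)

lemma holderBound_prod {ι : Type*} (s : Finset ι) (v : ι → HolderEven β) :
    HolderBound β (∏ i ∈ s, (v i).toCont) (∏ i ∈ s, ‖v i‖) := by
  classical
  induction s using Finset.induction_on with
  | empty => simpa using holderBound_one
  | insert i s hi ih =>
    rw [Finset.prod_insert hi, Finset.prod_insert hi]
    exact HolderBound.mul ⟨‖(v i).toCont‖, nnHolderNorm β (v i).toCont, norm_nonneg _,
      NNReal.coe_nonneg _, (HolderEven.norm_def (v i)).ge, (v i).abs_apply_le, (v i).abs_sub_le⟩ ih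

end HolderBound

lemma cosCoeff_const (m : ℕ) (c : ℝ) :
    cosCoeffC m (c • (1 : C(Torus, ℝ))) = if m = 0 then 2 * c else 0 := by
  rw [map_smul, cosCoeffC_apply, cosCoeff]
  have := integral_cos_int_mul m
  simp only [Int.cast_natCast, Nat.cast_eq_zero] at this
  simp only [ContinuousMap.one_apply, one_mul, this]
  split_ifs
  · simp; field_simp
  · simp

lemma cosCoeffC_const_zero {m : ℕ} (hm : m ≠ 0) (c : ℝ) :
    cosCoeffC m (c • (1 : C(Torus, ℝ))) = 0 := by
  rw [cosCoeff_const, if_neg hm]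

lemma torusMean_continuous_eq (F : C(Torus, ℝ)) : torusMean F = cosCoeffC 0 F / 2 :=
  torusMean_eq_cosCoeff F

lemma abs_torusMean_le (F : C(Torus, ℝ)) : |torusMean F| ≤ ‖F‖ := by
  have := abs_cosCoeff_le 0 F
  rw [torusMean_eq_cosCoeff, abs_div, abs_two]
  linarith

/-- Subtraction of the mean, as a linear map. -/
noncomputable def subMean : C(Torus, ℝ) →ₗ[ℝ] C(Torus, ℝ) :=
  LinearMap.id - ((1 / 2 : ℝ) • (cosCoeffC 0).toLinearMap).smulRight 1

lemma subMean_eq (F : C(Torus, ℝ)) : subMean F = F - torusMean F • (1 : C(Torus, ℝ)) := by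
  simp only [subMean, LinearMap.sub_apply, LinearMap.id_apply, LinearMap.smulRight_apply,
    LinearMap.smul_apply, smul_eq_mul, torusMean_continuous_eq]
  congr 2
  change 1 / 2 * cosCoeffC 0 F = _
  ring

lemma subMean_apply (F : C(Torus, ℝ)) (x : Torus) : subMean F x = F x - torusMean F := by
  rw [subMean_eq]; simp

lemma cosCoeff_subMean (F : C(Torus, ℝ)) {m : ℕ} (hm : m ≠ 0) :
    cosCoeff m (subMean F) = cosCoeff m F := by
  rw [subMean_eq, ← cosCoeffC_apply, map_sub, cosCoeff_const,
    if_neg hm, sub_zero, cosCoeffC_apply]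

lemma torusMean_subMean (F : C(Torus, ℝ)) : torusMean (subMean F) = 0 := by
  rw [torusMean_continuous_eq, subMean_eq, map_sub, cosCoeff_const,
    if_pos rfl, torusMean_continuous_eq]
  ring

namespace HolderEven

variable {β : ℝ≥0}

lemma subMean_prod_mem {ι : Type*} (s : Finset ι) (v : ι → HolderEven β) :
    subMean (∏ i ∈ s, (v i).toCont) ∈ holderEvenSubmodule β := by
  obtain ⟨a, h, ha, hh, hM, h1, h2⟩ := holderBound_prod s v
  refine ⟨(holderWith_of_abs_sub_le hh fun x y => ?_).memHolder, fun x => ?_, torusMean_subMean _⟩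
  · rw [subMean_apply, subMean_apply, sub_sub_sub_cancel_right]; exact h2 x y
  · simp [subMean_apply, ContinuousMap.prod_apply, even]

/-- The product of `p` functions minus its mean, as a multilinear map. -/
noncomputable def prodMeanLin (p : ℕ) :
    MultilinearMap ℝ (fun _ : Fin p => HolderEven β) (HolderEven β) :=
  let M : MultilinearMap ℝ (fun _ : Fin p => HolderEven β) C(Torus, ℝ) :=
    subMean.compMultilinearMap ((MultilinearMap.mkPiAlgebra ℝ (Fin p) C(Torus, ℝ)).compLinearMap
      fun _ => toContL.toLinearMap)
  { toFun := fun v => ofMem (subMean (∏ i, (v i).toCont)) (subMean_prod_mem _ v)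
    map_update_add' := fun v i x y => toCont_injective (M.map_update_add v i x y)
    map_update_smul' := fun v i c x => toCont_injective (M.map_update_smul v i c x) }

lemma toCont_prodMeanLin (p : ℕ) (v : Fin p → HolderEven β) :
    (prodMeanLin p v).toCont = subMean (∏ i, (v i).toCont) := rfl

/-- Subtracting the mean at most doubles the sup bound and leaves the Hölder constant unchanged. -/
lemma norm_prodMeanLin_le (p : ℕ) (v : Fin p → HolderEven β) :
    ‖prodMeanLin p v‖ ≤ 2 * ∏ i, ‖v i‖ := by
  obtain ⟨a, h, ha, hh, hM, h1, h2⟩ := holderBound_prod Finset.univ v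
  have hmean := (abs_torusMean_le (∏ i, (v i).toCont)).trans ((ContinuousMap.norm_le _ ha).2 h1)
  have := norm_le_add (prodMeanLin p v) (a := 2 * a) (b := h) (by positivity) hh (fun x => ?_)
    (fun x y => ?_)
  · linarith
  · rw [toCont_prodMeanLin, subMean_apply]
    exact (abs_sub _ _).trans (by linarith [h1 x])
  · rw [toCont_prodMeanLin, subMean_apply, subMean_apply, sub_sub_sub_cancel_right]; exact h2 x y

/-- The product of `p` functions minus its mean, as a continuous multilinear map. -/
noncomputable def prodMean (p : ℕ) :
    ContinuousMultilinearMap ℝ (fun _ : Fin p => HolderEven β) (HolderEven β) :=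
  (prodMeanLin p).mkContinuous 2 (norm_prodMeanLin_le p)

/-- The nonlinearity `φ ↦ φ ^ p - ⨍ φ ^ p`. -/
noncomputable def powMean (p : ℕ) (f : HolderEven β) : HolderEven β := prodMean p fun _ => f

lemma toCont_powMean (p : ℕ) (f : HolderEven β) : (powMean p f).toCont = subMean (f.toCont ^ p) := by
  have : (powMean p f).toCont = subMean (∏ _i : Fin p, f.toCont) := rfl
  rw [this, Finset.prod_const, Finset.card_univ, Fintype.card_fin]

lemma coeffL_powMean (p : ℕ) (f : HolderEven β) {m : ℕ} (hm : m ≠ 0) :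
    coeffL m (powMean p f) = cosCoeffC m (f.toCont ^ p) := by
  rw [coeffL_apply, toCont_powMean, cosCoeff_subMean _ hm]; rfl

lemma powMean_smul (p : ℕ) (s : ℝ) (f : HolderEven β) :
    powMean p (s • f) = s ^ p • powMean p f := by
  have := (prodMean (β := β) p).map_smul_univ (fun _ => s) (fun _ => f)
  simpa [powMean] using this

lemma norm_powMean_le (p : ℕ) (f : HolderEven β) : ‖powMean p f‖ ≤ 2 * ‖f‖ ^ p :=
  (norm_prodMeanLin_le p fun _ => f).trans_eq (by simp)

/-- A continuous multilinear map restricted to the diagonal. Here `⊤ : WithTop ℕ∞` is the analytic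
order, so this is analyticity. -/
lemma contDiff_powMean (p : ℕ) : ContDiff ℝ ⊤ (powMean (β := β) p) :=
  (prodMean p).contDiff.comp (contDiff_pi.2 fun _ => contDiff_id)

/-! ### The steady equation in terms of cosine coefficients -/

lemma isAbsDNegPow_iff (α : ℝ) (u v : HolderEven β) :
    IsAbsDNegPow α u v ↔ ∀ m ≠ 0, coeffL m v = (m : ℝ) ^ (-α) * coeffL m u := by
  constructor
  · intro h m hm
    have := h m
    rw [if_neg (by exact_mod_cast hm), fourierCoeff_ofReal _ u.even, fourierCoeff_ofReal _ v.even] at this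
    simp only [Int.natAbs_natCast, Int.cast_natCast, Nat.abs_cast] at this
    rw [← Complex.ofReal_mul, Complex.ofReal_inj] at this
    simp only [coeffL_apply]
    linarith
  · intro h m
    rw [fourierCoeff_ofReal _ u.even, fourierCoeff_ofReal _ v.even]
    split_ifs with hm
    · subst hm
      have := coeffL_zero v
      rw [coeffL_apply] at this
      simp [this]
    · rw [← Complex.ofReal_mul, Complex.ofReal_inj]
      have := h m.natAbs (by omega)
      simp only [coeffL_apply] at this
      rw [this, Nat.cast_natAbs, Int.cast_abs]
      ring

lemma isSteadySolution_iff (α : ℝ) (p : ℕ) (φ : HolderEven β) (c : ℝ) :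
    IsSteadySolution α p φ c ↔ ∀ m ≠ 0,
      c * coeffL m φ - coeffL m (powMean p φ) = (m : ℝ) ^ (-α) * coeffL m φ := by
  have h : (fun x => c * φ x - φ x ^ p + torusMean (fun y => φ y ^ p)) =
      (c • φ - powMean p φ : HolderEven β) := by
    funext x
    rw [toCont_sub, toCont_powMean, ContinuousMap.sub_apply, subMean_apply]
    simp only [toCont_smul, ContinuousMap.smul_apply, smul_eq_mul, ContinuousMap.coe_pow,
      Pi.pow_apply]
    rw [show (φ.toCont : Torus → ℝ) ^ p = fun y => φ y ^ p from rfl]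
    ring
  rw [IsSteadySolution, h, isAbsDNegPow_iff]
  simp only [map_sub, map_smul, smul_eq_mul]

end HolderEven

/-! ### Translations -/

/-- Translation of a function on the torus. -/
noncomputable def translate (a : Torus) (u : C(Torus, ℝ)) : C(Torus, ℝ) :=
  ⟨fun x => u (x + a), by fun_prop⟩

@[simp] lemma translate_apply (a : Torus) (u : C(Torus, ℝ)) (x : Torus) :
    translate a u x = u (x + a) := rfl

lemma fourierCoeff_translate (a : Torus) (u : Torus → ℂ) (m : ℤ) :
    fourierCoeff (fun x => u (x + a)) m = fourier m a * fourierCoeff u m := by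
  rw [fourierCoeff, fourierCoeff, ← MeasureTheory.integral_const_mul,
    ← MeasureTheory.integral_add_right_eq_self (μ := AddCircle.haarAddCircle)
      (fun t => fourier m a * (fourier (-m) t • u t)) a]
  refine MeasureTheory.integral_congr_ae (Eventually.of_forall fun x => ?_)
  simp only [smul_eq_mul]
  have h1 : fourier (-m) (x + a) = fourier (-m) x * fourier (-m) a := by
    simp only [fourier_apply, smul_add, AddCircle.toCircle_add, Circle.coe_mul]
  have h2 : fourier m a * fourier (-m) a = 1 := by
    rw [← fourier_add]; simp
  rw [h1]
  linear_combination (-(fourier (-m) x * u (x + a))) * h2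

lemma torusMean_eq_fourierCoeff (u : C(Torus, ℝ)) :
    ((torusMean u : ℝ) : ℂ) = fourierCoeff (fun x => (u x : ℂ)) 0 := by
  rw [fourierCoeff_eq_intervalIntegral _ 0 (-π), show -π + 2 * π = π by ring]
  simp only [neg_zero, fourier_zero, one_smul]
  rw [intervalIntegral.integral_ofReal, torusMean, ← Complex.coe_smul]
  push_cast
  rfl

lemma torusMean_translate (a : Torus) (u : C(Torus, ℝ)) :
    torusMean (translate a u) = torusMean u := by
  apply Complex.ofReal_injective
  rw [torusMean_eq_fourierCoeff, torusMean_eq_fourierCoeff]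
  have := fourierCoeff_translate a (fun x => (u x : ℂ)) 0
  rwa [fourier_zero, one_mul] at this

lemma IsSteadySolution.translate {α : ℝ} {p : ℕ} {u : C(Torus, ℝ)} {c : ℝ}
    (h : IsSteadySolution α p u c) (a : Torus) :
    IsSteadySolution α p (NegDispersion.translate a u) c := by
  have hm : torusMean (fun y => NegDispersion.translate a u y ^ p) = torusMean fun y => u y ^ p :=
    torusMean_translate a (u ^ p)
  intro m
  rw [hm]
  have h1 := fourierCoeff_translate a
    (fun x => ((c * u x - u x ^ p + torusMean (fun y => u y ^ p) : ℝ) : ℂ)) m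
  have h2 := fourierCoeff_translate a (fun x => (u x : ℂ)) m
  simp only [translate_apply]
  rw [h1, h2, h m]
  split_ifs
  · simp
  · ring

lemma fourier_eq_one_iff {k : ℕ} (hk : k ≠ 0) (m : ℤ) :
    fourier m ((2 * π / k : ℝ) : Torus) = 1 ↔ (k : ℤ) ∣ m := by
  have hk' : (k : ℂ) ≠ 0 := by exact_mod_cast hk
  have hpi : (π : ℂ) ≠ 0 := by exact_mod_cast pi_ne_zero
  rw [fourier_coe_apply, Complex.exp_eq_one_iff]
  constructor
  · rintro ⟨n, hn⟩
    refine ⟨n, ?_⟩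
    push_cast at hn
    have : (m : ℂ) = k * n := by
      have hI := Complex.I_ne_zero
      field_simp at hn
      linear_combination hn
    exact_mod_cast this
  · rintro ⟨n, rfl⟩
    refine ⟨n, ?_⟩
    push_cast
    field_simp

/-- Translation multiplies the m-th Fourier coefficient by e^{2πim/k}, which is 1 exactly when k
divides m. -/
lemma translate_eq_self_iff {k : ℕ} (hk : k ≠ 0) {u : C(Torus, ℝ)} (hu : ∀ x, u (-x) = u x) :
    translate ((2 * π / k : ℝ) : Torus) u = u ↔ ∀ m : ℕ, ¬ k ∣ m → cosCoeff m u = 0 := by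
  constructor
  · intro h m hm
    have h1 := fourierCoeff_translate ((2 * π / k : ℝ) : Torus) (fun x => (u x : ℂ)) m
    have h2 : (fun x : Torus => (u (x + ((2 * π / k : ℝ) : Torus)) : ℂ)) = fun x => (u x : ℂ) := by
      funext x
      exact congrArg _ (DFunLike.congr_fun h x)
    rw [h2] at h1
    have h3 : fourierCoeff (fun x => (u x : ℂ)) m = 0 := by
      by_contra hne
      have : fourier (m : ℤ) ((2 * π / k : ℝ) : Torus) = 1 := by
        have h4 : (fourier (m : ℤ) ((2 * π / k : ℝ) : Torus) - 1) *
            fourierCoeff (fun x => (u x : ℂ)) m = 0 := by linear_combination -h1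
        rcases mul_eq_zero.1 h4 with h5 | h5
        · exact sub_eq_zero.1 h5
        · exact absurd h5 hne
      exact hm (by exact_mod_cast (fourier_eq_one_iff hk m).1 this)
    rw [fourierCoeff_ofReal u hu] at h3
    simpa using h3
  · intro h
    refine eq_of_fourierCoeff_eq fun m => ?_
    have h1 := fourierCoeff_translate ((2 * π / k : ℝ) : Torus) (fun x => (u x : ℂ)) m
    refine h1.trans ?_
    by_cases hm : (k : ℤ) ∣ m
    · rw [(fourier_eq_one_iff hk m).2 hm, one_mul]
    · rw [fourierCoeff_ofReal u hu, h m.natAbs (by rwa [← Int.natCast_dvd])]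
      simp

/-! ### Small solutions of `w = t H(w)` -/

section FixedPoint

variable {E : Type*} [NormedAddCommGroup E] [NormedSpace ℝ E]

/-- Near zero, v ↦ t H(v) preserves Y and is Lipschitz with constant at most 1/2, so the distance of
a fixed point to Y is at most half of itself. It is used to show that the branch is 2π/k-periodic.
-/
lemma eventually_mem_of_fixedPoint {H : E → E} (hH : ContDiff ℝ ⊤ H) {Y : Submodule ℝ E}
    (hY : IsClosed (Y : Set E)) (hHY : ∀ w ∈ Y, H w ∈ Y) :
    ∀ᶠ q : ℝ × E in 𝓝 (0, 0), q.2 = q.1 • H q.2 → q.2 ∈ Y := by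
  obtain ⟨K, U, hU, hK⟩ := ContDiffAt.exists_lipschitzOnWith
    ((hH.of_le le_top : ContDiff ℝ 1 H).contDiffAt (x := 0))
  obtain ⟨r, hr, hrU⟩ := Metric.mem_nhds_iff.1 hU
  have h1 : ∀ᶠ q : ℝ × E in 𝓝 (0, 0), ‖q.2‖ < r / 4 := by
    have : Tendsto (fun q : ℝ × E => ‖q.2‖) (𝓝 (0, 0)) (𝓝 0) := by
      have : Continuous fun q : ℝ × E => ‖q.2‖ := by fun_prop
      simpa using this.tendsto (0, 0)
    exact this.eventually_lt_const (by positivity)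
  have h2 : ∀ᶠ q : ℝ × E in 𝓝 (0, 0), |q.1| * K < 1 / 2 := by
    have : Tendsto (fun q : ℝ × E => |q.1| * (K : ℝ)) (𝓝 (0, 0)) (𝓝 0) := by
      have : Continuous fun q : ℝ × E => |q.1| * (K : ℝ) := by fun_prop
      simpa using this.tendsto (0, 0)
    exact this.eventually_lt_const (by positivity)
  filter_upwards [h1, h2]
  rintro ⟨t, w⟩ hw ht heq
  simp only at hw ht heq ⊢
  have hne : (Y : Set E).Nonempty := ⟨0, Y.zero_mem⟩
  have hdw : Metric.infDist w Y ≤ ‖w‖ := by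
    simpa using Metric.infDist_le_dist_of_mem (x := w) (s := (Y : Set E)) Y.zero_mem
  have key : ∀ y ∈ (Y : Set E), 2 * Metric.infDist w Y ≤ dist w y := fun y hy => by
    by_cases hyr : ‖y‖ < r
    · have h3 : dist w (t • H y) ≤ |t| * (K * dist w y) := by
        conv_lhs => rw [heq]
        rw [dist_smul₀, Real.norm_eq_abs]
        gcongr
        exact hK.dist_le_mul w (hrU (by rw [mem_ball_zero_iff]; linarith)) y
          (hrU (by rwa [mem_ball_zero_iff]))
      have h4 := Metric.infDist_le_dist_of_mem (x := w) (s := (Y : Set E))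
        (Y.smul_mem t (hHY y hy))
      have h5 : |t| * (K * dist w y) ≤ 1 / 2 * dist w y := by
        rw [← mul_assoc]; gcongr
      linarith
    -- Points y outside the Lipschitz ball are harmless: dist(w, y) ≥ 3r/4, whereas 2‖w‖ < r/2.
    · have := norm_sub_norm_le y w
      rw [dist_comm, dist_eq_norm]
      linarith
  have h6 : 2 * Metric.infDist w Y ≤ Metric.infDist w Y :=
    (Metric.le_infDist hne).2 fun y hy => key y hy
  have h7 : Metric.infDist w Y = 0 := le_antisymm (by linarith) Metric.infDist_nonneg
  exact (hY.mem_iff_infDist_zero hne).2 h7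

/-- At t = 0 the map w - t H(w) is the identity in w, so the implicit function theorem applies at
the origin. -/
lemma exists_fixedPoint_branch [CompleteSpace E] {H : E → E} (hH : ContDiff ℝ ⊤ H) :
    ∃ w : ℝ → E, AnalyticAt ℝ w 0 ∧ w 0 = 0 ∧ (∀ᶠ t in 𝓝 0, w t = t • H (w t)) ∧
      ∀ᶠ q : ℝ × E in 𝓝 (0, 0), q.2 = q.1 • H q.2 → q.2 = w q.1 := by
  let f : ℝ × E → E := fun q => q.2 - q.1 • H q.2
  have hf : ContDiff ℝ ⊤ f := by
    have h1 : ContDiff ℝ ⊤ fun q : ℝ × E => H q.2 := hH.comp contDiff_snd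
    exact contDiff_snd.sub (contDiff_fst.smul h1)
  have hf' : fderiv ℝ f (0, 0) ∘L ContinuousLinearMap.inr ℝ ℝ E = ContinuousLinearMap.id ℝ E := by
    have hd := (hf.differentiable (by simp)).differentiableAt (x := ((0, 0) : ℝ × E))
    have h2 : HasFDerivAt (fun v : E => f (0, v))
        (fderiv ℝ f (0, 0) ∘L ContinuousLinearMap.inr ℝ ℝ E) 0 :=
      HasFDerivAt.comp (𝕜 := ℝ) (f := fun v : E => ((0 : ℝ), v)) (0 : E) hd.hasFDerivAt
        (hasFDerivAt_prodMk_right (0 : ℝ) (0 : E))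
    have h3 : (fun v : E => f (0, v)) = id := by funext v; simp [f]
    rw [h3] at h2
    exact h2.unique (hasFDerivAt_id 0)
  have hinv : (fderiv ℝ f (0, 0) ∘L ContinuousLinearMap.inr ℝ ℝ E).IsInvertible := by
    rw [hf']; exact ⟨ContinuousLinearEquiv.refl ℝ E, rfl⟩
  have hfc : ContDiffAt ℝ ⊤ f (0, 0) := hf.contDiffAt
  have hn : (⊤ : WithTop ℕ∞) ≠ 0 := by simp
  have huniq := hfc.eventually_apply_eq_iff_implicitFunction hn hinv
  have hself : hfc.implicitFunction hn hinv 0 = 0 := hfc.implicitFunction_apply_self hn hinv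
  have hsol := hfc.eventually_apply_implicitFunction hn hinv
  have hf0 : f (0, 0) = 0 := by simp [f]
  refine ⟨hfc.implicitFunction hn hinv,
    (hfc.contDiffAt_implicitFunction hn hinv).analyticAt, hself, ?_, ?_⟩
  · filter_upwards [hsol] with t ht
    rw [hf0] at ht
    exact sub_eq_zero.1 ht
  · filter_upwards [huniq] with q hq heq
    exact (hq.1 (by rw [hf0]; exact sub_eq_zero.2 heq)).symm

end FixedPoint

/-! ### Lyapunov–Schmidt reduction in rescaled variables. -/

namespace HolderEven

variable {β : ℝ≥0}

/-- The map `H` for which `s (cos k x + w)` solves the steady equation when `w = s ^ (p-1) H(w)`. -/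
noncomputable def reducedMap (S : HolderEven β →L[ℝ] HolderEven β) (p k : ℕ) (w : HolderEven β) :
    HolderEven β :=
  S (powMean p (cosine β k + w) - coeffL k (powMean p (cosine β k + w)) • w)

lemma contDiff_reducedMap (S : HolderEven β →L[ℝ] HolderEven β) (p k : ℕ) :
    ContDiff ℝ ⊤ (reducedMap S p k) := by
  have h1 : ContDiff ℝ ⊤ fun w : HolderEven β => powMean p (cosine β k + w) :=
    (contDiff_powMean p).comp (contDiff_const.add contDiff_id)
  have h2 : ContDiff ℝ ⊤ fun w : HolderEven β => coeffL k (powMean p (cosine β k + w)) :=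
    (coeffL k).contDiff.comp h1
  exact S.contDiff.comp (h1.sub (h2.smul contDiff_id))

section Reduction

variable {α : ℝ} {p k : ℕ} {S : HolderEven β →L[ℝ] HolderEven β}

/-- The symbol of S is zero at k, so the normalisation of w need not be imposed separately. -/
lemma coeffL_fixedPoint (hS : ∀ f m, coeffL m (S f) = invSymbol α k m * coeffL m f) {t : ℝ}
    {w : HolderEven β} (hw : w = t • reducedMap S p k w) : coeffL k w = 0 := by
  rw [hw, map_smul, reducedMap, hS, invSymbol, if_pos rfl, zero_mul, smul_zero]

lemma coeffL_branch (hβ : β ≤ 1) (hk : k ≠ 0)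
    (hS : ∀ f m, coeffL m (S f) = invSymbol α k m * coeffL m f) {t : ℝ}
    {w : HolderEven β} (hw : w = t • reducedMap S p k w) (s : ℝ) :
    coeffL k (s • (cosine β k + w)) = s := by
  rw [map_smul, map_add, coeffL_fixedPoint hS hw, coeffL_cosine hβ hk, if_pos rfl, add_zero,
    smul_eq_mul, mul_one]

lemma isSteadySolution_of_fixedPoint (hα : 0 < α) (hβ : β ≤ 1) (hk : k ≠ 0) (hp : p ≠ 0)
    (hS : ∀ f m, coeffL m (S f) = invSymbol α k m * coeffL m f) {s : ℝ} {w : HolderEven β}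
    (hw : w = s ^ (p - 1) • reducedMap S p k w) :
    IsSteadySolution α p (s • (cosine β k + w)).toCont
      ((k : ℝ) ^ (-α) + s ^ (p - 1) * coeffL k (powMean p (cosine β k + w))) := by
  have hs : s ^ p = s * s ^ (p - 1) := by rw [← pow_succ', Nat.sub_add_cancel (by omega)]
  rw [isSteadySolution_iff]
  intro m hm
  rw [powMean_smul, map_smul, map_smul, map_add, coeffL_cosine hβ hk, hs]
  simp only [smul_eq_mul]
  by_cases hmk : m = k
  · subst hmk
    rw [if_pos rfl, coeffL_fixedPoint hS hw]
    ring
  · have h1 : coeffL m w = s ^ (p - 1) * (invSymbol α k m *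
        (coeffL m (powMean p (cosine β k + w))
          - coeffL k (powMean p (cosine β k + w)) * coeffL m w)) := by
      conv_lhs => rw [hw]
      rw [map_smul, reducedMap, hS, map_sub, map_smul, smul_eq_mul, smul_eq_mul]
    have hne := rpow_neg_ne hα hmk
    rw [invSymbol, if_neg hmk] at h1
    have h2 : ((k : ℝ) ^ (-α) - (m : ℝ) ^ (-α)) * coeffL m w = s ^ (p - 1) *
        (coeffL m (powMean p (cosine β k + w))
          - coeffL k (powMean p (cosine β k + w)) * coeffL m w) := by
      conv_lhs => rw [h1]
      field_simp
    rw [if_neg hmk]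
    linear_combination s * h2

/-- The reduction before rescaling: nothing is divided by the k-th coefficient, which is not yet
known to be nonzero. -/
lemma reduction_of_isSteadySolution (hα : 0 < α) (hβ : β ≤ 1) (hk : k ≠ 0)
    (hS : ∀ f m, coeffL m (S f) = invSymbol α k m * coeffL m f) {φ : HolderEven β} {c : ℝ}
    (h : IsSteadySolution α p φ.toCont c) :
    φ - coeffL k φ • cosine β k =
      S (powMean p φ - (c - (k : ℝ) ^ (-α)) • (φ - coeffL k φ • cosine β k)) ∧
    (c - (k : ℝ) ^ (-α)) * coeffL k φ = coeffL k (powMean p φ) := by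
  rw [isSteadySolution_iff] at h
  refine ⟨ext_coeffL fun m hm => ?_, by linear_combination h k hk⟩
  rw [hS]
  simp only [map_sub, map_smul, coeffL_cosine hβ hk, smul_eq_mul, invSymbol]
  by_cases hmk : m = k
  · subst hmk; simp
  · have hne := rpow_neg_ne hα hmk
    rw [if_neg hmk, if_neg hmk]
    field_simp
    linear_combination h m hm

lemma fixedPoint_of_isSteadySolution (hα : 0 < α) (hβ : β ≤ 1) (hk : k ≠ 0) (hp : p ≠ 0)
    (hS : ∀ f m, coeffL m (S f) = invSymbol α k m * coeffL m f) {s : ℝ} (hs : s ≠ 0)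
    {w : HolderEven β} {c : ℝ} (hw : coeffL k w = 0)
    (h : IsSteadySolution α p (s • (cosine β k + w)).toCont c) :
    w = s ^ (p - 1) • reducedMap S p k w ∧
      c = (k : ℝ) ^ (-α) + s ^ (p - 1) * coeffL k (powMean p (cosine β k + w)) := by
  have hs' : s ^ p = s * s ^ (p - 1) := by rw [← pow_succ', Nat.sub_add_cancel (by omega)]
  obtain ⟨h1, h2⟩ := reduction_of_isSteadySolution hα hβ hk hS h
  have hc : coeffL k (s • (cosine β k + w)) = s := by
    rw [map_smul, map_add, hw, coeffL_cosine hβ hk, if_pos rfl, add_zero, smul_eq_mul, mul_one]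
  rw [hc, powMean_smul, map_smul, smul_eq_mul, hs'] at h2
  have h3 : c - (k : ℝ) ^ (-α) = s ^ (p - 1) * coeffL k (powMean p (cosine β k + w)) :=
    mul_left_cancel₀ hs (by linear_combination h2)
  refine ⟨?_, by linear_combination h3⟩
  rw [hc, h3, powMean_smul, smul_add, add_sub_cancel_left, hs', mul_smul, smul_comm _ s w,
    ← smul_sub, map_smul] at h1
  have h4 := smul_right_injective _ hs h1
  conv_lhs => rw [h4]
  rw [mul_smul, ← smul_sub, map_smul, reducedMap]

/-- With ψ = φ - s e, the unscaled reduction gives ‖ψ‖ ≤ ‖S‖(2‖φ‖^p + |c - k^{-α}| ‖ψ‖). Absorbing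
the last term yields ‖ψ‖ ≤ ε‖φ‖, and then ‖ψ‖ ≤ η|s|. So s = 0 would force φ = 0, and w = ψ/s is
small. -/
lemma eventually_normalForm (hα : 0 < α) (hβ : β ≤ 1) (hk : k ≠ 0) (hp : 2 ≤ p)
    (hS : ∀ f m, coeffL m (S f) = invSymbol α k m * coeffL m f) {η : ℝ} (hη : 0 < η) :
    ∀ᶠ q : HolderEven β × ℝ in 𝓝 (0, (k : ℝ) ^ (-α)), q.1 ≠ 0 →
      IsSteadySolution α p q.1.toCont q.2 → coeffL k q.1 ≠ 0 ∧ ∃ w : HolderEven β, ‖w‖ ≤ η ∧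
        q.1 = coeffL k q.1 • (cosine β k + w) ∧
        w = (coeffL k q.1) ^ (p - 1) • reducedMap S p k w ∧
        q.2 = (k : ℝ) ^ (-α) + (coeffL k q.1) ^ (p - 1) * coeffL k (powMean p (cosine β k + w)) := by
  set e := cosine β k with he
  -- The first bound lets ε‖ψ‖ be absorbed; the second makes the resulting 2ε‖e‖ |s| at most η|s|.
  set ε : ℝ := min (1 / 2) (η / (2 * (‖e‖ + 1))) with hε
  have hε0 : 0 < ε := by positivity
  have hε1 : ε ≤ 1 / 2 := min_le_left _ _
  have hε2 : 2 * ε * (‖e‖ + 1) ≤ η := by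
    have : ε ≤ η / (2 * (‖e‖ + 1)) := min_le_right _ _
    rw [le_div_iff₀ (by positivity)] at this
    linarith
  have ev1 : ∀ᶠ q : HolderEven β × ℝ in 𝓝 (0, (k : ℝ) ^ (-α)),
      ‖S‖ * |q.2 - (k : ℝ) ^ (-α)| < 1 / 2 := by
    have hc : Continuous fun q : HolderEven β × ℝ => ‖S‖ * |q.2 - (k : ℝ) ^ (-α)| := by fun_prop
    have := hc.tendsto (0, (k : ℝ) ^ (-α))
    simp only [sub_self, abs_zero, mul_zero] at this
    exact this.eventually_lt_const (by norm_num)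
  have ev2 : ∀ᶠ q : HolderEven β × ℝ in 𝓝 (0, (k : ℝ) ^ (-α)),
      -- The 4 is the constant 2 of `norm_powMean_le`, doubled by absorbing half of ‖ψ‖.
      4 * ‖S‖ * ‖q.1‖ ^ (p - 1) < ε := by
    have hc : Continuous fun q : HolderEven β × ℝ => 4 * ‖S‖ * ‖q.1‖ ^ (p - 1) := by fun_prop
    have := hc.tendsto (0, (k : ℝ) ^ (-α))
    simp only [norm_zero, zero_pow (show p - 1 ≠ 0 by omega), mul_zero] at this
    exact this.eventually_lt_const hε0
  filter_upwards [ev1, ev2]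
  rintro ⟨φ, c⟩ hc hφ hne hsol
  simp only at hc hφ hne hsol ⊢
  obtain ⟨h1, -⟩ := reduction_of_isSteadySolution hα hβ hk hS hsol
  set s := coeffL k φ with hs
  set ψ := φ - s • e with hψ
  have hφψ : ‖φ‖ ≤ |s| * ‖e‖ + ‖ψ‖ := by
    have : φ = s • e + ψ := by simp [hψ]
    conv_lhs => rw [this]
    exact (norm_add_le _ _).trans_eq (by rw [norm_smul, Real.norm_eq_abs])
  have h2 : ‖ψ‖ ≤ ‖S‖ * (2 * ‖φ‖ ^ p + |c - (k : ℝ) ^ (-α)| * ‖ψ‖) := by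
    conv_lhs => rw [h1]
    refine (S.le_opNorm _).trans ?_
    gcongr
    refine (norm_sub_le _ _).trans (add_le_add (norm_powMean_le p φ) ?_)
    rw [norm_smul, Real.norm_eq_abs]
  have h3 : ‖ψ‖ ≤ ε * ‖φ‖ := by
    have h4 : ‖φ‖ ^ p = ‖φ‖ ^ (p - 1) * ‖φ‖ := by rw [← pow_succ, Nat.sub_add_cancel (by omega)]
    have h5 : ‖S‖ * |c - (k : ℝ) ^ (-α)| * ‖ψ‖ ≤ 1 / 2 * ‖ψ‖ := by gcongr
    have h6 : 4 * ‖S‖ * ‖φ‖ ^ (p - 1) * ‖φ‖ ≤ ε * ‖φ‖ := by gcongr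
    rw [h4] at h2
    linarith
  have h7 : ‖ψ‖ ≤ η * |s| := by
    have h8 : ε * ‖φ‖ ≤ ε * (|s| * ‖e‖ + ‖ψ‖) := by gcongr
    have h9 : ε * ‖ψ‖ ≤ 1 / 2 * ‖ψ‖ := by gcongr
    have h10 : 2 * ε * (‖e‖ + 1) * |s| ≤ η * |s| := by gcongr
    nlinarith [mul_nonneg hε0.le (abs_nonneg s)]
  have hs0 : s ≠ 0 := fun h0 => hne <| by
    rw [h0, abs_zero, mul_zero] at h7
    have : ‖ψ‖ = 0 := le_antisymm h7 (norm_nonneg _)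
    rw [h0, abs_zero, zero_mul, zero_add, this] at hφψ
    exact norm_le_zero_iff.1 hφψ
  have hφ' : φ = s • (e + s⁻¹ • ψ) := by
    rw [smul_add, smul_inv_smul₀ hs0, hψ]; abel
  have hw0 : coeffL k (s⁻¹ • ψ) = 0 := by
    rw [map_smul, hψ, map_sub, map_smul, he, coeffL_cosine hβ hk, if_pos rfl, ← hs]; simp
  have hfp := fixedPoint_of_isSteadySolution (w := s⁻¹ • ψ) (c := c) hα hβ hk
    (by omega : p ≠ 0) hS hs0 hw0 (by rw [← he, ← hφ']; exact hsol)
  refine ⟨hs0, s⁻¹ • ψ, ?_, hφ', hfp.1, hfp.2⟩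
  rw [norm_smul, norm_inv, Real.norm_eq_abs, inv_mul_le_iff₀ (abs_pos.2 hs0), mul_comm]
  exact h7

end Reduction

/-! ### The subspace of `2π/k`-periodic functions -/

/-- The `2π/k`-periodic members of `𝒳^β`, described by their cosine coefficients. -/
noncomputable def periodicSubmodule (β : ℝ≥0) (k : ℕ) : Submodule ℝ (HolderEven β) :=
  ⨅ m : {m : ℕ // ¬ k ∣ m}, LinearMap.ker (coeffL (β := β) m.1).toLinearMap

lemma mem_periodicSubmodule {k : ℕ} {f : HolderEven β} :
    f ∈ periodicSubmodule β k ↔ ∀ m : ℕ, ¬ k ∣ m → coeffL m f = 0 := by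
  simp [periodicSubmodule, Submodule.mem_iInf]

lemma mem_periodicSubmodule_iff_translate {k : ℕ} (hk : k ≠ 0) {f : HolderEven β} :
    f ∈ periodicSubmodule β k ↔ translate ((2 * π / k : ℝ) : Torus) f.toCont = f.toCont := by
  rw [mem_periodicSubmodule, translate_eq_self_iff hk f.even]; rfl

lemma isClosed_periodicSubmodule (k : ℕ) : IsClosed (periodicSubmodule β k : Set (HolderEven β)) := by
  have : (periodicSubmodule β k : Set (HolderEven β)) =
      ⋂ m : {m : ℕ // ¬ k ∣ m}, {f | coeffL m.1 f = 0} := by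
    ext f; simp [mem_periodicSubmodule]
  rw [this]
  exact isClosed_iInter fun m => isClosed_eq (coeffL m.1).continuous continuous_const

lemma cosine_mem_periodicSubmodule (hβ : β ≤ 1) {k : ℕ} (hk : k ≠ 0) :
    cosine β k ∈ periodicSubmodule β k := by
  rw [mem_periodicSubmodule]
  intro m hm
  rw [coeffL_cosine hβ hk, if_neg]
  rintro rfl
  exact hm dvd_rfl

lemma powMean_mem_periodicSubmodule {k : ℕ} (hk : k ≠ 0) (p : ℕ) {f : HolderEven β}
    (hf : f ∈ periodicSubmodule β k) : powMean p f ∈ periodicSubmodule β k := by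
  rw [mem_periodicSubmodule_iff_translate hk] at hf ⊢
  ext x
  have := DFunLike.congr_fun hf x
  simp only [translate_apply] at this
  simp [toCont_powMean, subMean_apply, this]

lemma reducedMap_mem_periodicSubmodule (hβ : β ≤ 1) {α : ℝ} {k : ℕ} (hk : k ≠ 0) (p : ℕ)
    {S : HolderEven β →L[ℝ] HolderEven β}
    (hS : ∀ f m, coeffL m (S f) = invSymbol α k m * coeffL m f) {w : HolderEven β}
    (hw : w ∈ periodicSubmodule β k) : reducedMap S p k w ∈ periodicSubmodule β k := by
  have h1 := powMean_mem_periodicSubmodule hk p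
    (Submodule.add_mem _ (cosine_mem_periodicSubmodule hβ hk) hw)
  have h2 := Submodule.sub_mem _ h1
    (Submodule.smul_mem _ (coeffL k (powMean p (cosine β k + w))) hw)
  rw [mem_periodicSubmodule] at h2 ⊢
  intro m hm
  rw [reducedMap, hS, h2 m hm, mul_zero]

end HolderEven

open HolderEven

/-! ### Existence of the bifurcation curve -/

/-- The curve is φ(s) = s(e + w(s^{p-1})), with w the fixed-point branch. -/
theorem exists_localBifurcationCurve {α : ℝ} (hα : 0 < α) {p : ℕ} (hp : 2 ≤ p) {k : ℕ}
    (hk : k ≠ 0) {β : ℝ≥0} (hβ : β ≤ 1) :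
    ∃ (φ : ℝ → HolderEven β) (c : ℝ → ℝ), IsLocalBifurcationCurve α p k φ c ∧
      ∀ᶠ s in 𝓝 (0 : ℝ), cosCoeff k (φ s) = s := by
  obtain ⟨S, hS⟩ := exists_partialInverse (β := β) hβ hα hk
  have hH := contDiff_reducedMap S p k
  obtain ⟨w, hwa, hw0, hwsol, hwuniq⟩ := exists_fixedPoint_branch hH
  have hp1 : p - 1 ≠ 0 := by omega
  have hpow : Tendsto (fun s : ℝ => s ^ (p - 1)) (𝓝 0) (𝓝 0) := by
    have : Continuous fun s : ℝ => s ^ (p - 1) := by fun_prop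
    simpa [hp1] using this.tendsto 0
  have hsol : ∀ᶠ s : ℝ in 𝓝 0, w (s ^ (p - 1)) = s ^ (p - 1) • reducedMap S p k (w (s ^ (p - 1))) :=
    hpow.eventually hwsol
  have hwt : Tendsto w (𝓝 0) (𝓝 0) := by simpa [hw0] using hwa.continuousAt.tendsto
  have hper : ∀ᶠ s : ℝ in 𝓝 0, w (s ^ (p - 1)) ∈ periodicSubmodule β k := by
    have h1 := eventually_mem_of_fixedPoint hH (isClosed_periodicSubmodule (β := β) k)
      fun v hv => reducedMap_mem_periodicSubmodule hβ hk p hS hv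
    have h2 : Tendsto (fun s : ℝ => (s ^ (p - 1), w (s ^ (p - 1)))) (𝓝 0) (𝓝 (0, 0)) :=
      hpow.prodMk_nhds (hwt.comp hpow)
    filter_upwards [h2.eventually h1, hsol] with s hs1 hs2 using hs1 hs2
  have hcoef : ∀ᶠ s : ℝ in 𝓝 0, coeffL k (s • (cosine β k + w (s ^ (p - 1)))) = s := by
    filter_upwards [hsol] with s hs using coeffL_branch hβ hk hS hs s
  refine ⟨fun s => s • (cosine β k + w (s ^ (p - 1))), fun s => (k : ℝ) ^ (-α) +
    s ^ (p - 1) * coeffL k (powMean p (cosine β k + w (s ^ (p - 1)))), ⟨?_, ?_, ?_, ?_, ?_, ?_, ?_⟩,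
    hcoef⟩
  · have h1 : AnalyticAt ℝ (fun s : ℝ => s ^ (p - 1)) 0 := analyticAt_id.pow _
    have h2 : AnalyticAt ℝ (fun s : ℝ => cosine β k + w (s ^ (p - 1))) 0 :=
      analyticAt_const.add (AnalyticAt.comp_of_eq hwa h1 (by simp [hp1]))
    have h3 : AnalyticAt ℝ (fun s : ℝ => coeffL k (powMean p (cosine β k + w (s ^ (p - 1))))) 0 :=
      ((coeffL k).analyticAt _).comp ((contDiff_powMean p).contDiffAt.analyticAt.comp h2)
    exact (analyticAt_id.smul h2).prod (analyticAt_const.add (h1.mul h3))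
  · simp
  · simp [hp1]
  · filter_upwards [hsol] with s hs using
      isSteadySolution_of_fixedPoint hα hβ hk (by omega) hS hs
  · have := hcoef.filter_mono (nhdsWithin_le_nhds (s := {0}ᶜ))
    filter_upwards [this, self_mem_nhdsWithin] with s hs hs0 h0
    rw [h0, map_zero] at hs
    exact hs0 hs.symm
  · filter_upwards [hper] with s hs x
    have h1 := Submodule.smul_mem _ s (Submodule.add_mem _ (cosine_mem_periodicSubmodule hβ hk) hs)
    rw [mem_periodicSubmodule_iff_translate hk] at h1
    exact DFunLike.congr_fun h1 (x : Torus)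
  · intro δ hδ
    rw [nhds_prod_eq] at hwuniq
    obtain ⟨P, hP, Q, hQ, hPQ⟩ := eventually_prod_iff.1 hwuniq
    obtain ⟨η, hη, hηQ⟩ := Metric.eventually_nhds_iff.1 hQ
    have hs : Tendsto (fun q : HolderEven β × ℝ => coeffL k q.1) (𝓝 (0, (k : ℝ) ^ (-α))) (𝓝 0) := by
      have : Continuous fun q : HolderEven β × ℝ => coeffL k q.1 := by fun_prop
      simpa using this.tendsto (0, (k : ℝ) ^ (-α))
    -- Taking η/2 in the normal form puts v inside the neighbourhood where the branch is unique.
    filter_upwards [eventually_normalForm hα hβ hk hp hS (half_pos hη), hs.eventually (hpow.eventually hP),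
      hs.eventually (Ioo_mem_nhds (neg_lt_zero.2 hδ) hδ)] with q hq hqP hqδ hne hqs
    obtain ⟨-, v, hv, hq1, hv1, hq2⟩ := hq hne hqs
    have h1 : v = w ((coeffL k q.1) ^ (p - 1)) :=
      hPQ hqP (hηQ (by rw [dist_zero_right]; linarith)) hv1
    refine ⟨coeffL k q.1, hqδ, Prod.ext ?_ ?_⟩
    · simp only [← h1]; exact hq1
    · simp only [← h1]; exact hq2

/-! ### Powers of the cosine -/

/-- Pair j with p - j; a middle term is left unpaired only for even p. -/
lemma sum_range_eq_two_mul_of_symm {p : ℕ} {g : ℕ → ℝ} (hg : ∀ j ≤ p, g (p - j) = g j) :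
    ∑ j ∈ Finset.range (p + 1), g j =
      2 * ∑ j ∈ Finset.range ((p + 1) / 2), g j + if Even p then g (p / 2) else 0 := by
  have key : ∀ q r : ℕ, q + r = p + 1 → ∑ j ∈ Finset.range r, g (q + j) = ∑ j ∈ Finset.range r, g j :=
    fun q r hqr => by
      rw [← Finset.sum_range_reflect]
      refine Finset.sum_congr rfl fun j hj => ?_
      have hj' := Finset.mem_range.1 hj
      rw [← hg j (by omega)]
      congr 1; omega
  rcases Nat.even_or_odd' p with ⟨q, rfl | rfl⟩
  · rw [if_pos (even_two_mul q), show (2 * q + 1) / 2 = q by omega, show 2 * q / 2 = q by omega,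
      show 2 * q + 1 = q + 1 + q by ring, Finset.sum_range_add, key (q + 1) q (by ring),
      Finset.sum_range_succ]
    ring
  · rw [if_neg (by simp), show (2 * q + 1 + 1) / 2 = q + 1 by omega,
      show 2 * q + 1 + 1 = q + 1 + (q + 1) by ring, Finset.sum_range_add, key (q + 1) (q + 1) (by ring)]
    ring

/-- Real part of the binomial expansion of (e^{iθ} + e^{-iθ})^p. -/
lemma two_pow_mul_cos_pow (p : ℕ) (θ : ℝ) :
    2 ^ p * cos θ ^ p =
      ∑ j ∈ Finset.range (p + 1), (p.choose j : ℝ) * cos (((p : ℝ) - 2 * j) * θ) := by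
  have h : ((2 ^ p * cos θ ^ p : ℝ) : ℂ) =
      ∑ j ∈ Finset.range (p + 1), (p.choose j : ℂ) *
        Complex.exp (((((p : ℝ) - 2 * j) * θ : ℝ) : ℂ) * Complex.I) := by
    push_cast
    rw [← mul_pow, Complex.cos, mul_div_cancel₀ _ two_ne_zero, add_comm, add_pow]
    refine Finset.sum_congr rfl fun j hj => ?_
    have hj' : j ≤ p := Nat.lt_succ_iff.1 (Finset.mem_range.1 hj)
    rw [← Complex.exp_nat_mul, ← Complex.exp_nat_mul, ← Complex.exp_add, mul_comm, Nat.cast_sub hj']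
    congr 2
    ring
  have h2 := congrArg Complex.re h
  rw [Complex.ofReal_re, Complex.re_sum] at h2
  rw [h2]
  refine Finset.sum_congr rfl fun j _ => ?_
  rw [← Complex.ofReal_natCast, Complex.re_ofReal_mul, Complex.exp_ofReal_mul_I_re]

lemma cos_pow_eq {p : ℕ} (hp : p ≠ 0) (θ : ℝ) :
    cos θ ^ p = ∑ j ∈ Finset.range ((p + 1) / 2),
      (p.choose j : ℝ) / 2 ^ (p - 1) * cos (((p : ℝ) - 2 * j) * θ) +
        if Even p then (p.choose (p / 2) : ℝ) / 2 ^ p else 0 := by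
  have h1 := two_pow_mul_cos_pow p θ
  rw [sum_range_eq_two_mul_of_symm] at h1
  · have h2 : (2 : ℝ) ^ p = 2 * 2 ^ (p - 1) := by rw [← pow_succ', Nat.sub_add_cancel (by omega)]
    have h3 : ∑ j ∈ Finset.range ((p + 1) / 2),
        (p.choose j : ℝ) / 2 ^ (p - 1) * cos (((p : ℝ) - 2 * j) * θ) =
        (∑ j ∈ Finset.range ((p + 1) / 2), (p.choose j : ℝ) * cos (((p : ℝ) - 2 * j) * θ))
          / 2 ^ (p - 1) := by
      rw [Finset.sum_div]
      exact Finset.sum_congr rfl fun j _ => by ring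
    have h4 : cos θ ^ p = (2 ^ p * cos θ ^ p) / 2 ^ p := by field_simp
    rw [h4, h1, h3, add_div]
    congr 1
    · rw [h2, mul_div_mul_left _ _ two_ne_zero]
    · split_ifs with hev
      · obtain ⟨q, rfl⟩ := hev
        have : (((q + q : ℕ) : ℝ) - 2 * (((q + q) / 2 : ℕ) : ℝ)) * θ = 0 := by
          rw [show (q + q) / 2 = q by omega]; push_cast; ring
        rw [this, cos_zero, mul_one]
      · simp
  · intro j hj
    rw [Nat.choose_symm hj, Nat.cast_sub hj,
      show ((p : ℝ) - 2 * (p - j)) * θ = -((p - 2 * j) * θ) by ring, cos_neg]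

lemma cosC_pow {p : ℕ} (hp : p ≠ 0) (k : ℕ) :
    cosC k ^ p = ∑ j ∈ Finset.range ((p + 1) / 2),
      ((p.choose j : ℝ) / 2 ^ (p - 1)) • cosC ((p - 2 * j) * k) +
        (if Even p then (p.choose (p / 2) : ℝ) / 2 ^ p else 0) • 1 := by
  ext x
  induction x using QuotientAddGroup.induction_on with
  | H x =>
    change (cosC k (x : Torus)) ^ p = _
    rw [cosC_coe, cos_pow_eq hp, ContinuousMap.add_apply, ContinuousMap.sum_apply]
    congr 1
    · refine Finset.sum_congr rfl fun j hj => ?_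
      have hj' := Finset.mem_range.1 hj
      change _ = _ * cosC ((p - 2 * j) * k) (x : Torus)
      rw [cosC_coe]
      push_cast [Nat.cast_sub (show 2 * j ≤ p by omega)]
      ring_nf
    · split_ifs <;> simp

lemma cosCoeffC_cosC {m : ℕ} (hm : m ≠ 0) (n : ℕ) :
    cosCoeffC m (cosC n) = if n = m then 1 else 0 := by
  rw [cosCoeffC_apply, cosCoeff]
  simp only [cosC_coe]
  rw [integral_cos_mul_cos n m hm]
  split_ifs
  · field_simp
  · simp

lemma cosCoeffC_cosC_pow {p : ℕ} (hp : p ≠ 0) (k : ℕ) {m : ℕ} (hm : m ≠ 0) :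
    cosCoeffC m (cosC k ^ p) = ∑ j ∈ Finset.range ((p + 1) / 2),
      (p.choose j : ℝ) / 2 ^ (p - 1) * if (p - 2 * j) * k = m then 1 else 0 := by
  rw [cosC_pow hp, map_add, cosCoeffC_const_zero hm, add_zero, map_sum]
  refine Finset.sum_congr rfl fun j _ => ?_
  rw [map_smul, cosCoeffC_cosC hm, smul_eq_mul]

lemma cosCoeffC_cosC_pow_eq {p k i : ℕ} (hk : k ≠ 0) (hi : 2 * i < p) :
    cosCoeffC ((p - 2 * i) * k) (cosC k ^ p) = (p.choose i : ℝ) / 2 ^ (p - 1) := by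
  rw [cosCoeffC_cosC_pow (by omega) k (mul_ne_zero (by omega) hk),
    Finset.sum_eq_single_of_mem i (Finset.mem_range.2 (by omega))]
  · rw [if_pos rfl, mul_one]
  · intro j hj hji
    have := Finset.mem_range.1 hj
    rw [if_neg, mul_zero]
    intro h
    have := Nat.eq_of_mul_eq_mul_right (Nat.pos_of_ne_zero hk) h
    omega

/-- Only even multiples of k occur as frequencies. -/
lemma cosCoeffC_cosC_pow_of_even {p k : ℕ} (hp : Even p) (hp0 : p ≠ 0) (hk : k ≠ 0) :
    cosCoeffC k (cosC k ^ p) = 0 := by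
  rw [cosCoeffC_cosC_pow hp0 k hk]
  refine Finset.sum_eq_zero fun j hj => ?_
  have := Finset.mem_range.1 hj
  obtain ⟨q, rfl⟩ := hp
  rw [if_neg, mul_zero]
  intro h
  have := Nat.eq_of_mul_eq_mul_right (Nat.pos_of_ne_zero hk) (h.trans (one_mul k).symm)
  omega

lemma cosCoeffC_cosC_pow_of_odd {p k : ℕ} (hp : Odd p) (hk : k ≠ 0) :
    cosCoeffC k (cosC k ^ p) = speedOdd p := by
  obtain ⟨q, rfl⟩ := hp
  have := cosCoeffC_cosC_pow_eq (p := 2 * q + 1) (i := q) hk (by omega)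
  rw [show (2 * q + 1 - 2 * q) * k = k by rw [Nat.add_sub_cancel_left, one_mul]] at this
  rw [this, speedOdd, show (2 * q + 1 - 1) / 2 = q by omega]
  ring

/-- Both sides integrate the same function. This reduces the linear term of the speed to
coefficients of cos^p. -/
lemma cosCoeffC_cosC_pow_mul (p k m : ℕ) (hp : p ≠ 0) :
    cosCoeffC k (cosC k ^ (p - 1) * cosC m) = cosCoeffC m (cosC k ^ p) := by
  simp only [cosCoeffC_apply, cosCoeff]
  congr 2
  funext x
  simp only [ContinuousMap.mul_apply, ContinuousMap.pow_apply, cosC_coe]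
  rw [mul_right_comm, ← pow_succ, Nat.sub_add_cancel (by omega)]

/-! ### The second order profile -/

namespace HolderEven

variable {β : ℝ≥0}

/-- The second order profile as an element of `𝒳^β`. -/
noncomputable def profile (β : ℝ≥0) (α : ℝ) (p k : ℕ) : HolderEven β :=
  ∑ j ∈ Finset.range (p / 2), coeffC α p k j • cosine β ((p - 2 * j) * k)

lemma profile_coe (hβ : β ≤ 1) (α : ℝ) (p : ℕ) {k : ℕ} (hk : k ≠ 0) (x : ℝ) :
    profile β α p k (x : Torus) = ∑ j ∈ Finset.range (p / 2), phiTerm α p k j x := by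
  rw [profile, toCont_sum, ContinuousMap.sum_apply]
  refine Finset.sum_congr rfl fun j hj => ?_
  have := Finset.mem_range.1 hj
  rw [toCont_smul, ContinuousMap.smul_apply, cosine_coe hβ (mul_ne_zero (by omega) hk), smul_eq_mul,
    phiTerm]
  push_cast [Nat.cast_sub (show 2 * j ≤ p by omega)]
  rfl

lemma powMean_cosine (hβ : β ≤ 1) {p k : ℕ} (hp : p ≠ 0) (hk : k ≠ 0) :
    powMean p (cosine β k) = ∑ j ∈ Finset.range ((p + 1) / 2),
      ((p.choose j : ℝ) / 2 ^ (p - 1)) • cosine β ((p - 2 * j) * k) := by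
  refine ext_coeffL fun m hm => ?_
  rw [coeffL_powMean p _ hm, toCont_cosine hβ hk, cosCoeffC_cosC_pow hp k hm, map_sum]
  refine Finset.sum_congr rfl fun j hj => ?_
  have := Finset.mem_range.1 hj
  rw [map_smul, coeffL_cosine hβ (mul_ne_zero (by omega) hk), smul_eq_mul]
  simp only [eq_comm]

/-- Each cosine is an eigenvector of S, so S acts termwise on the expansion of cos^p. -/
lemma reducedMap_zero (hβ : β ≤ 1) {α : ℝ} {p k : ℕ} (hp : p ≠ 0) (hk : k ≠ 0)
    {S : HolderEven β →L[ℝ] HolderEven β}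
    (hS : ∀ f m, coeffL m (S f) = invSymbol α k m * coeffL m f) :
    reducedMap S p k 0 = profile β α p k := by
  have hSc : ∀ n : ℕ, n ≠ 0 → S (cosine β n) = invSymbol α k n • cosine β n := fun n hn =>
    ext_coeffL fun m _ => by
      rw [hS, map_smul, coeffL_cosine hβ hn, smul_eq_mul]
      split_ifs with h
      · rw [h]
      · simp
  rw [reducedMap, add_zero, smul_zero, sub_zero, powMean_cosine hβ hp hk, map_sum, profile]
  have hterm : ∀ j ∈ Finset.range (p / 2),
      S (((p.choose j : ℝ) / 2 ^ (p - 1)) • cosine β ((p - 2 * j) * k)) =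
        coeffC α p k j • cosine β ((p - 2 * j) * k) := fun j hj => by
    have := Finset.mem_range.1 hj
    have hne : (p - 2 * j) * k ≠ k := fun h => by
      have := Nat.eq_of_mul_eq_mul_right (Nat.pos_of_ne_zero hk) (h.trans (one_mul k).symm)
      omega
    rw [map_smul, hSc _ (mul_ne_zero (by omega) hk), smul_smul, invSymbol, if_neg hne, coeffC]
    push_cast [Nat.cast_sub (show 2 * j ≤ p by omega)]
    rw [mul_one_div]
  rw [← Finset.sum_congr rfl hterm]
  rcases Nat.even_or_odd' p with ⟨q, rfl | rfl⟩
  · rw [show (2 * q + 1) / 2 = 2 * q / 2 by omega]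
  -- For odd p the expansion has one more term, of frequency k, which S annihilates.
  · rw [show (2 * q + 1 + 1) / 2 = (2 * q + 1) / 2 + 1 by omega, Finset.sum_range_succ,
      show (2 * q + 1) / 2 = q by omega, add_eq_left, map_smul,
      show (2 * q + 1 - 2 * q) * k = k by rw [Nat.add_sub_cancel_left, one_mul], hSc k hk, invSymbol,
      if_pos rfl, zero_smul, smul_zero]

lemma speedEven_eq (hβ : β ≤ 1) (α : ℝ) {p k : ℕ} (hp : 2 ≤ p) (hk : k ≠ 0) :
    p * cosCoeffC k (cosC k ^ (p - 1) * (profile β α p k).toCont) = speedEven α p k := by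
  have h1 : cosCoeffC k (cosC k ^ (p - 1) * (profile β α p k).toCont) =
      ∑ j ∈ Finset.range (p / 2), coeffC α p k j * ((p.choose j : ℝ) / 2 ^ (p - 1)) := by
    rw [profile, toCont_sum, Finset.mul_sum, map_sum]
    refine Finset.sum_congr rfl fun j hj => ?_
    have := Finset.mem_range.1 hj
    rw [toCont_smul, mul_smul_comm, map_smul, toCont_cosine hβ (mul_ne_zero (by omega) hk),
      cosCoeffC_cosC_pow_mul p k _ (by omega), cosCoeffC_cosC_pow_eq hk (by omega), smul_eq_mul]
  -- The term j = 0 is split off because Pascal's rule, used for the others, needs j ≥ 1.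
  rw [h1, speedEven, Finset.range_eq_Ico, Finset.sum_eq_sum_Ico_succ_bot (by omega), mul_add, mul_add,
    Finset.mul_sum, Finset.mul_sum]
  congr 1
  · simp; ring
  · refine Finset.sum_congr rfl fun j hj => ?_
    have hj' := Finset.mem_Ico.1 hj
    have h2 : p.choose j = (p - 1).choose j + (p - 1).choose (j - 1) := by
      obtain ⟨q, rfl⟩ : ∃ q, p = q + 1 := ⟨p - 1, by omega⟩
      obtain ⟨i, rfl⟩ : ∃ i, j = i + 1 := ⟨j - 1, by omega⟩
      rw [Nat.choose_succ_succ, add_comm]; rfl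
    rw [h2]
    push_cast
    ring

end HolderEven

/-! ### Auxiliary estimates -/

lemma isBigO_pow_zero_of_le {m n : ℕ} (h : n ≤ m) :
    (fun s : ℝ => s ^ m) =O[𝓝 0] fun s : ℝ => s ^ n := by
  rcases h.eq_or_lt with rfl | h
  · exact isBigO_refl _ _
  · exact (isLittleO_pow_pow h).isBigO

/-- A quadratic Taylor remainder for powers, obtained by multiplying the expansion for p by a + b.
-/
lemma exists_norm_add_pow_sub_le {R : Type*} [NormedCommRing R] [NormOneClass R] (p : ℕ) :
    ∃ C : ℝ, 0 ≤ C ∧ ∀ a b : R, ‖a‖ ≤ 1 → ‖b‖ ≤ 1 →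
      ‖(a + b) ^ p - a ^ p - p * (a ^ (p - 1) * b)‖ ≤ C * ‖b‖ ^ 2 := by
  induction p with
  | zero => exact ⟨0, le_rfl, fun a b _ _ => by simp⟩
  | succ p ih =>
    obtain ⟨C, hC, h⟩ := ih
    refine ⟨2 * C + p, by positivity, fun a b ha hb => ?_⟩
    have key : (a + b) ^ (p + 1) - a ^ (p + 1) - ((p + 1 : ℕ) : R) * (a ^ (p + 1 - 1) * b) =
        (a + b) * ((a + b) ^ p - a ^ p - p * (a ^ (p - 1) * b)) + p * (a ^ (p - 1) * b ^ 2) := by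
      rcases p with _ | q
      · simp
      · simp only [Nat.add_sub_cancel]; push_cast; ring
    rw [key]
    have hab : ‖a + b‖ ≤ 2 := (norm_add_le _ _).trans (by linarith)
    have hp : ‖(p : R)‖ ≤ p := by
      simpa using Nat.norm_cast_le (α := R) p
    have hap : ‖a ^ (p - 1)‖ ≤ 1 := (norm_pow_le _ _).trans (pow_le_one₀ (norm_nonneg _) ha)
    calc ‖(a + b) * ((a + b) ^ p - a ^ p - p * (a ^ (p - 1) * b)) + p * (a ^ (p - 1) * b ^ 2)‖
        ≤ ‖a + b‖ * ‖(a + b) ^ p - a ^ p - p * (a ^ (p - 1) * b)‖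
          + ‖(p : R)‖ * (‖a ^ (p - 1)‖ * ‖b‖ ^ 2) := by
          refine (norm_add_le _ _).trans (add_le_add (norm_mul_le _ _) ((norm_mul_le _ _).trans ?_))
          gcongr
          exact (norm_mul_le _ _).trans (by gcongr; exact norm_pow_le _ _)
      _ ≤ 2 * (C * ‖b‖ ^ 2) + p * (1 * ‖b‖ ^ 2) := by
          gcongr
          exact h a b ha hb
      _ = (2 * C + p) * ‖b‖ ^ 2 := by ring

/-- Write f = s^m g with g(0) ≠ 0. The bound forces m ≥ 2n - 1, and m = 2n - 1 would make g odd near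
0, hence g(0) = 0. -/
lemma isBigO_pow_of_even {f : ℝ → ℝ} (hf : AnalyticAt ℝ f 0) (heven : ∀ᶠ s in 𝓝 (0 : ℝ), f (-s) = f s)
    {n : ℕ} (hn : n ≠ 0) (hO : f =O[𝓝 0] fun s : ℝ => s ^ (2 * n - 1)) :
    f =O[𝓝 0] fun s : ℝ => s ^ (2 * n) := by
  by_cases h0 : ∀ᶠ s in 𝓝 (0 : ℝ), f s = 0
  · exact (isBigO_zero _ _).congr' (h0.mono fun s hs => hs.symm) EventuallyEq.rfl
  obtain ⟨m, g, hg, hg0, hfg⟩ := hf.exists_eventuallyEq_pow_smul_nonzero_iff.2 h0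
  simp only [sub_zero, smul_eq_mul] at hfg
  have hgt : Tendsto g (𝓝 0) (𝓝 (g 0)) := hg.continuousAt
  have hgO : g =O[𝓝 0] fun _ : ℝ => (1 : ℝ) := hgt.isBigO_one ℝ
  have hm1 : 2 * n - 1 ≤ m := by
    by_contra! hlt
    have h1 : g =O[𝓝[≠] 0] fun s : ℝ => s ^ (2 * n - 1 - m) := by
      have h2 := (hO.mono nhdsWithin_le_nhds).mul (isBigO_refl (fun s : ℝ => (s ^ m)⁻¹) (𝓝[≠] 0))
      refine h2.congr' ?_ ?_
      · filter_upwards [hfg.filter_mono nhdsWithin_le_nhds, self_mem_nhdsWithin] with s hs hs0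
        have : s ≠ 0 := hs0
        rw [hs]; field_simp
      · filter_upwards [self_mem_nhdsWithin] with s hs0
        have : s ≠ 0 := hs0
        rw [pow_sub₀ s this hlt.le]
    have h3 : Tendsto (fun s : ℝ => s ^ (2 * n - 1 - m)) (𝓝[≠] 0) (𝓝 0) := by
      have : Continuous fun s : ℝ => s ^ (2 * n - 1 - m) := by fun_prop
      have := (this.tendsto 0).mono_left (nhdsWithin_le_nhds (s := {0}ᶜ))
      rwa [zero_pow (by omega)] at this
    exact hg0 (tendsto_nhds_unique (hgt.mono_left nhdsWithin_le_nhds) (h1.trans_tendsto h3))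
  have hm2 : m ≠ 2 * n - 1 := by
    intro hm
    have hneg : Tendsto (fun s : ℝ => -s) (𝓝 0) (𝓝 0) := by
      simpa using (continuous_neg.tendsto (0 : ℝ))
    have hodd : ∀ᶠ s in 𝓝[≠] (0 : ℝ), g s = -g (-s) := by
      filter_upwards [hfg.filter_mono nhdsWithin_le_nhds, heven.filter_mono nhdsWithin_le_nhds,
        (hneg.eventually hfg).filter_mono nhdsWithin_le_nhds, self_mem_nhdsWithin] with s h1 h2 h3 hs0
      have hs : s ≠ 0 := hs0
      have hmo : Odd m := by rw [hm]; exact ⟨n - 1, by omega⟩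
      rw [h1, h3, hmo.neg_pow] at h2
      have hsm : s ^ m ≠ 0 := pow_ne_zero _ hs
      exact mul_left_cancel₀ hsm (by linarith)
    have h4 : Tendsto (fun s => -g (-s)) (𝓝[≠] 0) (𝓝 (-g 0)) :=
      ((hgt.comp hneg).neg).mono_left nhdsWithin_le_nhds
    have h5 := tendsto_nhds_unique ((hgt.mono_left nhdsWithin_le_nhds).congr' hodd) h4
    exact hg0 (by linarith)
  have h6 : (fun s : ℝ => s ^ m) =O[𝓝 0] fun s : ℝ => s ^ (2 * n) := isBigO_pow_zero_of_le (by omega)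
  refine (h6.mul hgO).congr' (hfg.mono fun s hs => hs.symm) ?_
  simp

/-! ### Symmetry of the speed -/

namespace HolderEven

variable {β : ℝ≥0}

/-- Translation in `𝒳^β`, with value zero where the translate is not even. -/
noncomputable def shift (a : Torus) (f : HolderEven β) : HolderEven β :=
  open Classical in
  if h : translate a f.toCont ∈ holderEvenSubmodule β then ofMem (translate a f.toCont) h else 0

/-- The default value 0 keeps the bound free of any periodicity condition, so the shifted curve
tends to 0 without further argument. -/
lemma norm_shift_le (a : Torus) (f : HolderEven β) : ‖shift a f‖ ≤ ‖f‖ := by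
  rw [shift]
  split_ifs with h
  · rw [norm_def f]
    refine norm_le_add _ (norm_nonneg _) (NNReal.coe_nonneg _) (fun x => f.abs_apply_le (x + a))
      fun x y => ?_
    have := f.abs_sub_le (x + a) (y + a)
    rwa [dist_add_right] at this
  · simp

/-- Evenness survives since f(-x + π/k) = f(x - π/k) = f(x + π/k), by evenness and 2π/k-periodicity.
-/
lemma toCont_shift {k : ℕ} {f : HolderEven β}
    (hf : translate ((2 * π / k : ℝ) : Torus) f.toCont = f.toCont) :
    (shift ((π / k : ℝ) : Torus) f).toCont = translate ((π / k : ℝ) : Torus) f.toCont := by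
  have h : translate ((π / k : ℝ) : Torus) f.toCont ∈ holderEvenSubmodule β := by
    refine ⟨(holderWith_of_abs_sub_le (b := nnHolderNorm β f.toCont) (NNReal.coe_nonneg _)
      fun x y => ?_).memHolder, fun x => ?_, (torusMean_translate _ _).trans f.mean_eq_zero⟩
    · have := f.abs_sub_le (x + ((π / k : ℝ) : Torus)) (y + ((π / k : ℝ) : Torus))
      rwa [dist_add_right] at this
    · have h1 := DFunLike.congr_fun hf (-x + -((π / k : ℝ) : Torus))
      simp only [translate_apply] at h1 ⊢
      rw [← f.even (x + _), neg_add, ← h1]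
      congr 1
      rw [add_assoc, ← AddCircle.coe_neg, ← AddCircle.coe_add]
      congr 2
      ring
  rw [shift, dif_pos h]; rfl

lemma coeffL_shift {k : ℕ} (hk : k ≠ 0) {f : HolderEven β}
    (hf : translate ((2 * π / k : ℝ) : Torus) f.toCont = f.toCont) :
    coeffL k (shift ((π / k : ℝ) : Torus) f) = -coeffL k f := by
  have hk' : (k : ℂ) ≠ 0 := by exact_mod_cast hk
  have h1 := fourierCoeff_ofReal _ (shift ((π / k : ℝ) : Torus) f).even k
  have h2 := fourierCoeff_ofReal _ f.even k
  have h3 := fourierCoeff_translate ((π / k : ℝ) : Torus) (fun x => (f x : ℂ)) k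
  have h4 : fourier (k : ℤ) ((π / k : ℝ) : Torus) = -1 := by
    have hpi : (π : ℂ) ≠ 0 := by exact_mod_cast pi_ne_zero
    rw [fourier_coe_apply, show 2 * (π : ℂ) * Complex.I * ((k : ℤ) : ℂ) * ((π / k : ℝ) : ℂ)
      / ((2 * π : ℝ) : ℂ) = π * Complex.I by push_cast; field_simp, Complex.exp_pi_mul_I]
  rw [toCont_shift hf] at h1
  have h5 := h1.symm.trans (h3.trans (by rw [h4, h2]))
  rw [Int.natAbs_natCast] at h5
  rw [coeffL_apply, coeffL_apply, toCont_shift hf]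
  have h6 : cosCoeff k (translate ((π / k : ℝ) : Torus) f.toCont) / 2 = -(cosCoeff k f.toCont / 2) := by
    apply Complex.ofReal_injective
    rw [h5]; push_cast; ring
  linarith

end HolderEven

section Curve

variable {α : ℝ} {p k : ℕ} {β : ℝ≥0} {φ : ℝ → HolderEven β} {c : ℝ → ℝ}

lemma IsLocalBifurcationCurve.tendsto (h : IsLocalBifurcationCurve α p k φ c) :
    Tendsto (fun s => (φ s, c s)) (𝓝 0) (𝓝 (0, (k : ℝ) ^ (-α))) := by
  have := h.analytic.continuousAt.tendsto
  rwa [h.start_fst, h.start_snd] at this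

/-- The shift of φ(s) by π/k is a solution with the same speed and k-th coefficient -s. Exhaustion
puts it on the curve, and the parametrisation identifies its parameter as -s. -/
lemma IsLocalBifurcationCurve.speed_even (h : IsLocalBifurcationCurve α p k φ c) (hk : k ≠ 0)
    (hs : ∀ᶠ s in 𝓝 (0 : ℝ), cosCoeff k (φ s) = s) : ∀ᶠ s in 𝓝 (0 : ℝ), c (-s) = c s := by
  -- The parametrisation must hold on all of (-δ, δ), as it is used at a parameter known only to lie
  -- there.
  obtain ⟨δ, hδ, hδs⟩ := Metric.eventually_nhds_iff.1 hs
  have ht : Tendsto (fun s => (shift ((π / k : ℝ) : Torus) (φ s), c s)) (𝓝 0)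
      (𝓝 (0, (k : ℝ) ^ (-α))) := by
    have h1 := h.tendsto
    rw [Prod.tendsto_iff] at h1 ⊢
    refine ⟨squeeze_zero_norm (fun s => norm_shift_le _ (φ s)) ?_, h1.2⟩
    simpa using h1.1.norm
  filter_upwards [ht.eventually (h.exhaustive δ hδ), h.solution, h.periodic, hs] with s h1 h2 h3 h4
  rcases eq_or_ne s 0 with rfl | hs0
  · simp
  have hper : translate ((2 * π / k : ℝ) : Torus) (φ s).toCont = (φ s).toCont := by
    ext x
    induction x using QuotientAddGroup.induction_on with
    | H x => exact h3 x
  have hco : coeffL k (shift ((π / k : ℝ) : Torus) (φ s)) = -s := by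
    rw [coeffL_shift hk hper, coeffL_apply, h4]
  have hne : shift ((π / k : ℝ) : Torus) (φ s) ≠ 0 := fun h0 => by
    rw [h0, map_zero] at hco
    exact hs0 (by linarith)
  have hsol : IsSteadySolution α p (shift ((π / k : ℝ) : Torus) (φ s)).toCont (c s) := by
    rw [toCont_shift hper]; exact h2.translate _
  obtain ⟨s', hs', heq⟩ := h1 hne hsol
  have e1 : shift ((π / k : ℝ) : Torus) (φ s) = φ s' := congrArg Prod.fst heq
  have e2 : c s = c s' := congrArg Prod.snd heq
  have e3 : s' = -s := by
    rw [← hco, e1, coeffL_apply]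
    exact (hδs (by rw [dist_zero_right, Real.norm_eq_abs, abs_lt]; exact hs')).symm
  rw [e2, e3]

/-- `eventually_normalForm` applies along any given curve, so the asymptotics do not depend on how
the curve was constructed. -/
lemma IsLocalBifurcationCurve.exists_normalForm (h : IsLocalBifurcationCurve α p k φ c)
    (hs : ∀ᶠ s in 𝓝 (0 : ℝ), cosCoeff k (φ s) = s) (hα : 0 < α) (hβ : β ≤ 1) (hk : k ≠ 0)
    (hp : 2 ≤ p) {S : HolderEven β →L[ℝ] HolderEven β}
    (hS : ∀ f m, coeffL m (S f) = invSymbol α k m * coeffL m f) :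
    ∃ w : ℝ → HolderEven β, Tendsto w (𝓝 0) (𝓝 0) ∧ ∀ᶠ s in 𝓝 (0 : ℝ),
      φ s = s • (cosine β k + w s) ∧ w s = s ^ (p - 1) • reducedMap S p k (w s) ∧
      c s = (k : ℝ) ^ (-α) + s ^ (p - 1) * coeffL k (powMean p (cosine β k + w s)) := by
  have hp1 : p - 1 ≠ 0 := by omega
  have hnt : ∀ᶠ s in 𝓝 (0 : ℝ), s ≠ 0 → φ s ≠ 0 := by
    have := h.nontrivial
    rwa [eventually_nhdsWithin_iff] at this
  -- w(s) = φ(s)/s - e, with the case distinction making w(0) = 0 so that all identities also hold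
  -- at s = 0.
  have key : ∀ η > 0, ∀ᶠ s in 𝓝 (0 : ℝ), ‖s⁻¹ • φ s - if s = 0 then 0 else cosine β k‖ ≤ η ∧
      φ s = s • (cosine β k + (s⁻¹ • φ s - if s = 0 then 0 else cosine β k)) ∧
      (s⁻¹ • φ s - if s = 0 then 0 else cosine β k) =
        s ^ (p - 1) • reducedMap S p k (s⁻¹ • φ s - if s = 0 then 0 else cosine β k) ∧
      c s = (k : ℝ) ^ (-α) + s ^ (p - 1) * coeffL k (powMean p
        (cosine β k + (s⁻¹ • φ s - if s = 0 then 0 else cosine β k))) := by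
    intro η hη
    filter_upwards [h.tendsto.eventually (eventually_normalForm hα hβ hk hp hS hη), h.solution, hs,
      hnt] with s h1 h2 h3 h4
    rcases eq_or_ne s 0 with rfl | hs0
    · simp [h.start_fst, h.start_snd, hp1, hη.le]
    · rw [if_neg hs0]
      obtain ⟨-, v, hv, h5, h6, h7⟩ := h1 (h4 hs0) h2
      have h8 : coeffL k (φ s) = s := h3
      simp only [h8] at h5 h6 h7
      have h9 : s⁻¹ • φ s - cosine β k = v := by
        rw [h5, inv_smul_smul₀ hs0, add_sub_cancel_left]
      rw [h9]
      exact ⟨hv, h5, h6, h7⟩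
  refine ⟨fun s => s⁻¹ • φ s - if s = 0 then 0 else cosine β k, ?_, ?_⟩
  · rw [Metric.tendsto_nhds]
    intro η hη
    filter_upwards [key (η / 2) (half_pos hη)] with s hs
    rw [dist_zero_right]
    exact hs.1.trans_lt (half_lt_self hη)
  · filter_upwards [key 1 one_pos] with s hs using hs.2

end Curve

/-! ### Asymptotics of the curve -/

section Asymptotics

variable {α : ℝ} {p k : ℕ} {β : ℝ≥0} {φ : ℝ → HolderEven β} {c : ℝ → ℝ}
  {S : HolderEven β →L[ℝ] HolderEven β} {w : ℝ → HolderEven β}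

/-- Continuity of H bounds H(w), which gives the size of w through the fixed-point equation;
differentiability at 0 then gives the second estimate. -/
lemma isBigO_reducedMap_sub (hw : Tendsto w (𝓝 0) (𝓝 0))
    (hfp : ∀ᶠ s in 𝓝 (0 : ℝ), w s = s ^ (p - 1) • reducedMap S p k (w s)) :
    w =O[𝓝 0] (fun s : ℝ => s ^ (p - 1)) ∧
      (fun s => reducedMap S p k (w s) - reducedMap S p k 0) =O[𝓝 0] fun s : ℝ => s ^ (p - 1) := by
  have hH := contDiff_reducedMap S p k
  have h1 : (fun s => reducedMap S p k (w s)) =O[𝓝 0] fun _ : ℝ => (1 : ℝ) :=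
    ((hH.continuous.tendsto 0).comp hw).isBigO_one ℝ
  have h2 : w =O[𝓝 0] fun s : ℝ => s ^ (p - 1) := by
    have := (isBigO_refl (fun s : ℝ => s ^ (p - 1)) (𝓝 0)).smul h1
    refine this.congr' (hfp.mono fun s hs => hs.symm) ?_
    simp
  refine ⟨h2, ?_⟩
  have h3 := ((hH.differentiable (by simp)).differentiableAt (x := 0)).hasFDerivAt.isBigO_sub
  have h4 := h3.comp_tendsto hw
  simp only [Function.comp_def, sub_zero] at h4
  exact h4.trans h2

lemma IsLocalBifurcationCurve.expansion (h : IsLocalBifurcationCurve α p k φ c)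
    (hs : ∀ᶠ s in 𝓝 (0 : ℝ), cosCoeff k (φ s) = s) (hα : 0 < α) (hβ : β ≤ 1) (hk : k ≠ 0)
    (hp : 2 ≤ p) :
    ∃ r : ℝ → HolderEven β, (∀ s, φ s = s • cosine β k + s ^ p • profile β α p k + r s) ∧
      r =O[𝓝 0] fun s : ℝ => s ^ (2 * p - 1) := by
  obtain ⟨S, hS⟩ := exists_partialInverse (β := β) hβ hα hk
  obtain ⟨w, hw, hnf⟩ := h.exists_normalForm hs hα hβ hk hp hS
  obtain ⟨-, h2⟩ := isBigO_reducedMap_sub hw (hnf.mono fun s hs => hs.2.1)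
  rw [reducedMap_zero hβ (by omega) hk hS] at h2
  refine ⟨fun s => φ s - (s • cosine β k + s ^ p • profile β α p k), fun s => (add_sub_cancel _ _).symm, ?_⟩
  -- The remainder is s^p (H(w) - H(0)), of order p + (p - 1).
  have h3 := (isBigO_refl (fun s : ℝ => s ^ p) (𝓝 0)).smul h2
  refine h3.congr' ?_ (Eventually.of_forall fun s => ?_)
  · filter_upwards [hnf] with s hs
    have hsp : s ^ p = s * s ^ (p - 1) := by rw [← pow_succ', Nat.sub_add_cancel (by omega)]
    rw [hs.1, smul_sub, smul_add, add_sub_add_left_eq_sub]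
    congr 1
    conv_rhs => rw [hs.2.1]
    rw [hsp, mul_smul]
  · simp only [smul_eq_mul]
    rw [← pow_add]; congr 1; omega

lemma IsLocalBifurcationCurve.speed_odd (h : IsLocalBifurcationCurve α p k φ c)
    (hs : ∀ᶠ s in 𝓝 (0 : ℝ), cosCoeff k (φ s) = s) (hα : 0 < α) (hβ : β ≤ 1) (hk : k ≠ 0)
    (hp : 2 ≤ p) (hodd : Odd p) :
    (fun s => c s - ((k : ℝ) ^ (-α) + s ^ (p - 1) * speedOdd p))
      =O[𝓝 0] fun s : ℝ => s ^ (2 * p - 2) := by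
  obtain ⟨S, hS⟩ := exists_partialInverse (β := β) hβ hα hk
  obtain ⟨w, hw, hnf⟩ := h.exists_normalForm hs hα hβ hk hp hS
  obtain ⟨h1, -⟩ := isBigO_reducedMap_sub hw (hnf.mono fun s hs => hs.2.1)
  have hN := (((coeffL k).contDiff.comp (contDiff_powMean p)).differentiable (by simp)
    ).differentiableAt (x := cosine β k)
  have h2 := hN.hasFDerivAt.isBigO_sub
  have hw' : Tendsto (fun s => cosine β k + w s) (𝓝 0) (𝓝 (cosine β k)) := by
    simpa using tendsto_const_nhds.add hw
  have h3 := h2.comp_tendsto hw'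
  simp only [Function.comp_def, add_sub_cancel_left] at h3
  rw [coeffL_powMean p _ hk, toCont_cosine hβ hk, cosCoeffC_cosC_pow_of_odd hodd hk] at h3
  have h4 := (isBigO_refl (fun s : ℝ => s ^ (p - 1)) (𝓝 0)).mul (h3.trans h1)
  refine h4.congr' ?_ (Eventually.of_forall fun s => ?_)
  · filter_upwards [hnf] with s hs
    rw [hs.2.2]; ring
  · simp only
    rw [← pow_add]; congr 1; omega

lemma norm_cosC_le (k : ℕ) : ‖cosC k‖ ≤ 1 :=
  (ContinuousMap.norm_le _ zero_le_one).2 fun x => by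
    induction x using QuotientAddGroup.induction_on with
    | H x =>
      change ‖cosC k (x : Torus)‖ ≤ 1
      rw [cosC_coe]; exact abs_cos_le_one _

/-- N(e)_k = 0, so the speed is governed by the linear term p A(w) with w ≈ s^{p-1} H(0). Both the
quadratic remainder and the error in w contribute O(s^{3p-3}) to c. -/
lemma IsLocalBifurcationCurve.speed_of_even (h : IsLocalBifurcationCurve α p k φ c)
    (hs : ∀ᶠ s in 𝓝 (0 : ℝ), cosCoeff k (φ s) = s) (hα : 0 < α) (hβ : β ≤ 1) (hk : k ≠ 0)
    (hp : 2 ≤ p) (heven : Even p) :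
    (fun s => c s - ((k : ℝ) ^ (-α) + s ^ (2 * p - 2) * speedEven α p k))
      =O[𝓝 0] fun s : ℝ => s ^ (2 * p) := by
  obtain ⟨S, hS⟩ := exists_partialInverse (β := β) hβ hα hk
  obtain ⟨w, hw, hnf⟩ := h.exists_normalForm hs hα hβ hk hp hS
  obtain ⟨h1, h2⟩ := isBigO_reducedMap_sub hw (hnf.mono fun s hs => hs.2.1)
  rw [reducedMap_zero hβ (by omega) hk hS] at h2
  set A : HolderEven β →L[ℝ] ℝ := (cosCoeffC k).comp
    ((ContinuousLinearMap.mul ℝ C(Torus, ℝ) (cosC k ^ (p - 1))).comp toContL) with hA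
  have hAv : ∀ v : HolderEven β, A v = cosCoeffC k (cosC k ^ (p - 1) * v.toCont) := fun v => rfl
  have hpp : ∀ s : ℝ, s ^ (p - 1) * s ^ (p - 1) = s ^ (2 * p - 2) := fun s => by
    rw [← pow_add]; congr 1; omega
  have hquad : (fun s => coeffL k (powMean p (cosine β k + w s)) - p * A (w s))
      =O[𝓝 0] fun s : ℝ => s ^ (2 * p - 2) := by
    obtain ⟨C, hC, hCest⟩ := exists_norm_add_pow_sub_le (R := C(Torus, ℝ)) p
    have h3 : (fun s => coeffL k (powMean p (cosine β k + w s)) - p * A (w s))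
        =O[𝓝 0] fun s => ‖w s‖ * ‖w s‖ := by
      refine IsBigO.of_bound (‖cosCoeffC k‖ * C) ?_
      have hw1 : ∀ᶠ s in 𝓝 (0 : ℝ), ‖w s‖ < 1 := by
        have := hw.norm
        rw [norm_zero] at this
        exact this.eventually_lt_const one_pos
      filter_upwards [hw1] with s hs1
      have e1 : coeffL k (powMean p (cosine β k + w s)) - p * A (w s) =
          cosCoeffC k ((cosC k + (w s).toCont) ^ p - cosC k ^ p
            - p * (cosC k ^ (p - 1) * (w s).toCont)) := by
        rw [coeffL_powMean p _ hk, toCont_add, toCont_cosine hβ hk, map_sub, map_sub,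
          cosCoeffC_cosC_pow_of_even heven (by omega) hk, sub_zero, hAv,
          ← nsmul_eq_mul p (cosC k ^ (p - 1) * (w s).toCont),
          map_nsmul, nsmul_eq_mul]
      rw [e1, mul_assoc]
      refine ((cosCoeffC k).le_opNorm _).trans ?_
      have hwc := (w s).norm_toCont_le
      gcongr
      refine (hCest _ _ (norm_cosC_le k) (hwc.trans hs1.le)).trans ?_
      rw [norm_mul, norm_norm, ← sq]
      gcongr
    refine h3.trans ((h1.norm_left.mul h1.norm_left).congr_right hpp)
  have hlin : (fun s => p * A (w s) - s ^ (p - 1) * speedEven α p k)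
      =O[𝓝 0] fun s : ℝ => s ^ (2 * p - 2) := by
    have h3 := (isBigO_refl (fun s : ℝ => s ^ (p - 1)) (𝓝 0)).mul
      ((A.isBigO_comp (fun s => reducedMap S p k (w s) - profile β α p k) (𝓝 0)).trans h2)
    refine ((h3.const_mul_left (p : ℝ)).congr_right hpp).congr' ?_ EventuallyEq.rfl
    filter_upwards [hnf] with s hs
    conv_rhs => rw [hs.2.1]
    rw [← speedEven_eq hβ α hp hk, ← hAv, map_sub, map_smul, smul_eq_mul]
    ring
  have hO : (fun s => c s - ((k : ℝ) ^ (-α) + s ^ (2 * p - 2) * speedEven α p k))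
      =O[𝓝 0] fun s : ℝ => s ^ (2 * p - 1) := by
    have h3 := (isBigO_refl (fun s : ℝ => s ^ (p - 1)) (𝓝 0)).mul (hquad.add hlin)
    -- 3p - 3 ≥ 2p - 1 for p ≥ 2, with equality at p = 2; there the missing power comes only from
    -- evenness.
    have h4 : (fun s : ℝ => s ^ (p - 1) * s ^ (2 * p - 2)) =O[𝓝 0] fun s : ℝ => s ^ (2 * p - 1) := by
      simp only [← pow_add]
      exact isBigO_pow_zero_of_le (by omega)
    refine (h3.trans h4).congr' ?_ EventuallyEq.rfl
    filter_upwards [hnf] with s hs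
    rw [hs.2.2, ← hpp]
    ring
  refine isBigO_pow_of_even ?_ ?_ (by omega) hO
  · have hc : AnalyticAt ℝ c 0 :=
      (ContinuousLinearMap.snd ℝ (HolderEven β) ℝ).analyticAt _ |>.comp h.analytic
    exact hc.sub (analyticAt_const.add ((analyticAt_id.pow _).mul analyticAt_const))
  · filter_upwards [h.speed_even hk hs] with s hs
    have : Even (2 * p - 2) := ⟨p - 1, by omega⟩
    rw [hs, this.neg_pow]

end Asymptotics

end NegDispersion
-- Assembly of the theorem.
open NegDispersion
theorem mainTheorem10 (α : ℝ) (hα0 : 0 < α) (hα1 : α < 1) (p : ℕ) (hp : 2 ≤ p)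
    (k : ℕ) (hk : 1 ≤ k) (β : ℝ≥0) (hβ : max α (1 / 2) < (β : ℝ)) (hβ1 : β < 1) :
    (∃ (φ : ℝ → HolderEven β) (c : ℝ → ℝ), IsLocalBifurcationCurve α p k φ c ∧
      ∀ᶠ s in 𝓝 (0 : ℝ), cosCoeff k (φ s) = s) ∧
    ∀ (φ : ℝ → HolderEven β) (c : ℝ → ℝ), IsLocalBifurcationCurve α p k φ c →
      (∀ᶠ s in 𝓝 (0 : ℝ), cosCoeff k (φ s) = s) →
      (∀ᶠ s in 𝓝 (0 : ℝ), c (-s) = c s) ∧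
      (Even p →
        (∃ r : ℝ → HolderEven β,
          (∀ᶠ s in 𝓝 (0 : ℝ), ∀ x : ℝ,
            φ s (x : Torus) = s * cos (k * x) + s ^ p * phiEven α p k x + r s (x : Torus)) ∧
          r =O[𝓝 0] fun s : ℝ => s ^ (2 * p - 1)) ∧
        (fun s => c s - ((k : ℝ) ^ (-α) + s ^ (2 * p - 2) * speedEven α p k))
          =O[𝓝 0] fun s : ℝ => s ^ (2 * p)) ∧
      (Odd p →
        (∃ r : ℝ → HolderEven β,
          (∀ᶠ s in 𝓝 (0 : ℝ), ∀ x : ℝ,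
            φ s (x : Torus) = s * cos (k * x) + s ^ p * phiOdd α p k x + r s (x : Torus)) ∧
          r =O[𝓝 0] fun s : ℝ => s ^ (2 * p - 1)) ∧
        (fun s => c s - ((k : ℝ) ^ (-α) + s ^ (p - 1) * speedOdd p))
          =O[𝓝 0] fun s : ℝ => s ^ (2 * p - 2)) := by
  have hk0 : k ≠ 0 := by omega
  refine ⟨exists_localBifurcationCurve hα0 hp hk0 hβ1.le, fun φ c h hs => ?_⟩
  obtain ⟨r, hr, hrO⟩ := h.expansion hs hα0 hβ1.le hk0 hp
  have hpt : ∀ (s x : ℝ), φ s (x : Torus) = s * cos (k * x) +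
      s ^ p * ∑ j ∈ Finset.range (p / 2), phiTerm α p k j x + r s (x : Torus) := fun s x => by
    rw [← HolderEven.profile_coe hβ1.le α p hk0, ← HolderEven.cosine_coe hβ1.le hk0]
    conv_lhs => rw [hr s]
    rfl
  refine ⟨h.speed_even hk0 hs, fun hev => ⟨⟨r, Eventually.of_forall hpt, hrO⟩,
    h.speed_of_even hs hα0 hβ1.le hk0 hp hev⟩, fun hodd => ⟨⟨r, ?_, hrO⟩,
    h.speed_odd hs hα0 hβ1.le hk0 hp hodd⟩⟩
  refine Eventually.of_forall fun s x => ?_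
  -- For odd p the two summation ranges coincide, so one profile serves both parities.
  rw [phiOdd, show (p - 1) / 2 = p / 2 by obtain ⟨q, rfl⟩ := hodd; omega]
  exact hpt s x
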